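/- Let $1\le m\le n$ be integers. Regard hyperbolic space of curvature $-1$ in geodesic polar coordinates as $S^n\times(0,\infty)$ with the metric $h=d\rho^2+\sinh^2\!\rho\;e$, where $e$ is the standard metric of the unit sphere $S^n\subset\mathbb R^{n+1}$. For a positive function $z\in C^2(S^n)$ let $\lambda(z(u))=(\lambda_1,\dots,\lambda_n)$ be the principal curvatures, with respect to the inner normal, of the radial graph $M=\{(u,z(u)):u\in S^n\}$ at the point $(u,z(u))$. Put $$H_m(\lambda)=\binom nm^{-1}\sum_{i_1<\dots<i_m}\lambda_{i_1}\cdots\lambda_{i_m},$$ and let $\Gamma_m$ be the connected component of $\{\lambda\in\mathbb R^n: H_m(\lambda)>0\}$ that contains the positive cone $\{\lambda_1,\dots,\lambda_n>0\}$. A positive function $z\in C^2(S^n)$ is called $m$-admissible if $\lambda(z(u))\in\Gamma_m$ for every $u\in S^n$. Let $0<R_1<R_2<\infty$, and let $\psi(u,\rho)$ be a positive smooth function on the closed annulus $\bar\Omega=\{(u,\rho):u\in S^n,\ R_1\le\rho\le R_2\}$ such that $$\frac{\partial}{\partial\rho}\bigl[\psi(u,\rho)\sinh^m\rho\bigr]\le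 0\qquad\text{for all }u\in S^n,\ \rho\in[R_1,R_2]. \tag{$*$}$$ Let $z_1,z_2$ be $m$-admissible functions with $R_1\le z_k(u)\le R_2$ and $$H_m(\lambda(z_k(u)))=\psi(u,z_k(u))\qquad\text{for all }u\in S^n,\ k=1,2.$$ Then there is a constant $c>0$ such that $$c\,\tanh\frac{z_1(u)}2=\tanh\frac{z_2(u)}2\qquad\text{for all }u\in S^n.$$ If moreover the inequality in $(*)$ is strict for all $u\in S^n$ and $\rho\in[R_1,R_2]$, then $c=1$, that is, $z_1=z_2$: there is at most one hypersurface in $\bar\Omega$ that is the radial graph of an $m$-admissible solution. -/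

import Mathlib

open scoped Manifold ContDiff

noncomputable section

/-- The Euclidean space `ℝᵏ`. -/
abbrev EucSp (k : ℕ) : Type := EuclideanSpace ℝ (Fin k)

/-- The unit sphere `Sⁿ` of `ℝⁿ⁺¹`. -/
abbrev UnitSphere (n : ℕ) : Type := Metric.sphere (0 : EucSp (n + 1)) 1

section Curvature

/-- Christoffel symbols of the first kind of a metric `G` on an open subset of a vector space `V`:
`christoffelOne G p X Y Z = G p (Γ p (X, Y)) Z`, where `Γ` is the Levi-Civita connection
(Koszul formula for constant vector fields). -/
def christoffelOne {V : Type*} [NormedAddCommGroup V] [NormedSpace ℝ V]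
    (G : V → V → V → ℝ) (p X Y Z : V) : ℝ :=
  (fderiv ℝ (fun q => G q Y Z) p X + fderiv ℝ (fun q => G q X Z) p Y
    - fderiv ℝ (fun q => G q X Y) p Z) / 2

/-- First fundamental form, at the parameter `y`, of a parametrized hypersurface `r : U → V` in
the Riemannian metric `G`. -/
def firstForm {U V : Type*} [NormedAddCommGroup U] [NormedSpace ℝ U]
    [NormedAddCommGroup V] [NormedSpace ℝ V]
    (G : V → V → V → ℝ) (r : U → V) (y ξ η : U) : ℝ :=
  G (r y) (fderiv ℝ r y ξ) (fderiv ℝ r y η)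

/-- Second fundamental form with respect to the normal vector `N`: the number
`G (∇_ξ (∂_η r), N)`, where `∇` is the Levi-Civita connection of `G`. -/
def secondForm {U V : Type*} [NormedAddCommGroup U] [NormedSpace ℝ U]
    [NormedAddCommGroup V] [NormedSpace ℝ V]
    (G : V → V → V → ℝ) (r : U → V) (N : V) (y ξ η : U) : ℝ :=
  G (r y) (fderiv ℝ (fun w => fderiv ℝ r w η) y ξ) N
    + christoffelOne G (r y) (fderiv ℝ r y ξ) (fderiv ℝ r y η) N

/-- The Gram matrix, in the standard basis, of a form on `ℝⁿ`. -/
def formMatrix {n : ℕ} (B : EucSp n → EucSp n → ℝ) : Matrix (Fin n) (Fin n) ℝ :=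
  Matrix.of fun i j => B (EuclideanSpace.single i 1) (EuclideanSpace.single j 1)

end Curvature

section HyperbolicSpace

variable {n : ℕ}

/-- The standard metric of `Sⁿ` in a local chart `e`, that is, the one induced from `ℝⁿ⁺¹`. -/
def sphereMetric (e : OpenPartialHomeomorph (UnitSphere n) (EucSp n)) (y ξ η : EucSp n) : ℝ :=
  inner ℝ (fderiv ℝ (fun w => (e.symm w : EucSp (n + 1))) y ξ)
    (fderiv ℝ (fun w => (e.symm w : EucSp (n + 1))) y η)

/-- The metric `dρ² + sinh² ρ · e` of hyperbolic space on `Sⁿ × (0, ∞)`, in the local coordinates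
`(y, ρ)` in which `y` are the coordinates of a chart of `Sⁿ`. -/
def hyperbolicMetric (e : OpenPartialHomeomorph (UnitSphere n) (EucSp n))
    (p X Y : EucSp n × ℝ) : ℝ :=
  X.2 * Y.2 + Real.sinh p.2 ^ 2 * sphereMetric e p.1 X.1 Y.1

/-- The radial graph `u ↦ (u, z u)` in the same local coordinates. -/
def radialGraph (e : OpenPartialHomeomorph (UnitSphere n) (EucSp n)) (z : UnitSphere n → ℝ)
    (y : EucSp n) : EucSp n × ℝ :=
  (y, z (e.symm y))

/-- `N` is the inner unit normal of the radial graph of `z` at the parameter `y`: it is a unit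
vector orthogonal to the tangent space, and its `ρ`-component is negative. -/
structure IsInnerNormal (e : OpenPartialHomeomorph (UnitSphere n) (EucSp n))
    (z : UnitSphere n → ℝ) (y : EucSp n) (N : EucSp n × ℝ) : Prop where
  unit : hyperbolicMetric e (radialGraph e z y) N N = 1
  orthogonal : ∀ ξ : EucSp n,
    hyperbolicMetric e (radialGraph e z y) (fderiv ℝ (radialGraph e z) y ξ) N = 0
  inward : N.2 < 0

/-- `κ` lists, with multiplicity, the principal curvatures at `(u, z u)` of the radial graph of `z`
in hyperbolic space, with respect to the inner normal. They are the roots of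
`det (b - x g) = 0`, where `g` and `b` are the matrices of the two fundamental forms
(in the chart of the sphere at `u`), so that `κ` is determined up to the order of its entries. -/
def IsPrincipalCurvatures (z : UnitSphere n → ℝ) (u : UnitSphere n) (κ : Fin n → ℝ) : Prop :=
  let e := chartAt (EucSp n) u
  ∃ N : EucSp n × ℝ, IsInnerNormal e z (e u) N ∧
    let g := formMatrix (firstForm (hyperbolicMetric e) (radialGraph e z) (e u))
    let b := formMatrix (secondForm (hyperbolicMetric e) (radialGraph e z) N (e u))
    ∀ x : ℝ, (b - x • g).det = g.det * ∏ i, (κ i - x)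

/-- The normalized `m`-th elementary symmetric function `H_m` on `ℝⁿ`. -/
def meanCurv (m : ℕ) (κ : Fin n → ℝ) : ℝ :=
  (∑ s ∈ Finset.powersetCard m Finset.univ, ∏ i ∈ s, κ i) / (n.choose m : ℝ)

/-- `Γ_m`: the connected component of `{H_m > 0}` that contains the positive cone. -/
def gammaCone (n m : ℕ) : Set (Fin n → ℝ) :=
  connectedComponentIn {κ : Fin n → ℝ | 0 < meanCurv m κ} (fun _ => 1)

/-- A function on the sphere is `m`-admissible if it is positive, `C²`, and the principal
curvatures of its radial graph lie in `Γ_m` at every point. -/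
structure IsAdmissible (m : ℕ) (z : UnitSphere n → ℝ) : Prop where
  pos : ∀ u, 0 < z u
  contMDiff : ContMDiff (𝓡 n) 𝓘(ℝ, ℝ) 2 z
  mem_gammaCone : ∀ u, ∃ κ : Fin n → ℝ, IsPrincipalCurvatures z u κ ∧ κ ∈ gammaCone n m

/-- The radial graph of `z` solves `H_m (κ (z u)) = ψ (u, z u)` at every point `u` of the sphere. -/
def SolvesCurvatureEq (m : ℕ) (ψ : UnitSphere n → ℝ → ℝ) (z : UnitSphere n → ℝ) : Prop :=
  ∀ u, ∃ κ : Fin n → ℝ, IsPrincipalCurvatures z u κ ∧ meanCurv m κ = ψ u (z u)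

end HyperbolicSpace

end

/-! The proof is a maximum principle for `v = log (tanh (z / 2))`. Since `dv = dz / sinh z`, the
hyperbolic metric is `sinh² ρ` times the cylinder metric `dv² + e`. Let `C = e + dv ⊗ dv` be the
first form of the graph in the cylinder, and let `ν > 0` be minus the radial component of the inner
normal. The hyperbolic forms are then `g = sinh² z · C` and `b = ν sinh z · (-Hess v + cosh z · C)`,
so the numbers `sinh z · κᵢ / ν` are the eigenvalues of `-Hess v + cosh z · C` relative to `C`
(`IsPrincipalCurvatures.smul_pencil`).

If `z₁ > z₂` somewhere, the same holds at a maximum of `v₁ - v₂`. There the gradients agree, hence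
so do `C` and `ν`, while `Hess v₁ ≤ Hess v₂` and `cosh z₁ > cosh z₂`. The pencil of `z₁` thus
exceeds that of `z₂` by a positive definite form. Strict monotonicity of `H_m` on Gårding's cone
(`Matrix.esymm_lt_of_posDef_sub`) gives `sinh^m z₁ · H_m(κ₁) > sinh^m z₂ · H_m(κ₂)`
(`sinh_pow_mul_meanCurv_lt`), against the monotonicity of `ψ sinh^m`. Strictness comes from `cosh`,
so the weak inequality on `ψ` already forces `z₁ = z₂` and `c = 1`.

The algebraic input is that `Γ_m` lies in the cone where the elementary symmetric functions `e_0, …,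
e_m` are all positive (`gammaCone_subset`), and that `e_m` increases there under rank-one
perturbations. Both rest on Newton's inequalities, derived from Laguerre's inequality for
real-rooted polynomials. -/

/-! ### Elementary symmetric functions of a multiset. -/

theorem Multiset.esymm_cons_succ {R : Type*} [CommSemiring R] (a : R) (s : Multiset R) (k : ℕ) :
    (a ::ₘ s).esymm (k + 1) = s.esymm (k + 1) + a * s.esymm k := by
  simp only [Multiset.esymm, Multiset.powersetCard_cons, Multiset.map_add, Multiset.sum_add,
    Multiset.map_map, Function.comp_def, Multiset.prod_cons, Multiset.sum_map_mul_left]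

theorem Multiset.esymm_zero_right {R : Type*} [CommSemiring R] (s : Multiset R) :
    s.esymm 0 = 1 := by
  simp [Multiset.esymm]

theorem Multiset.esymm_eq_zero_of_card_lt {R : Type*} [CommSemiring R] (s : Multiset R) {k : ℕ}
    (h : s.card < k) : s.esymm k = 0 := by
  simp [Multiset.esymm, Multiset.powersetCard_eq_empty _ h]

/-! ### Real-rooted polynomials and Laguerre's inequality. -/

namespace Polynomial

/-- The derivative of a real polynomial with only real roots has only real roots. -/
theorem Splits.derivative_real {p : ℝ[X]} (hp : p.Splits) : (derivative p).Splits := by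
  by_cases h0 : p.natDegree = 0
  · rw [derivative_of_natDegree_zero h0]; exact Splits.zero
  rw [splits_iff_card_roots] at hp ⊢
  -- Rolle, with multiplicities: at most one root is lost, and the degree drops by at least one.
  have h1 := card_roots_le_derivative p
  have h2 := card_roots' (derivative p)
  have h3 := natDegree_derivative_lt h0
  omega

theorem Splits.iterate_derivative_real {p : ℝ[X]} (hp : p.Splits) (k : ℕ) :
    (derivative^[k] p).Splits := by
  induction k with
  | zero => exact hp
  | succ k ih => rw [Function.iterate_succ_apply']; exact ih.derivative_real

/-- Laguerre's inequality for products of linear factors. -/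
theorem laguerre_prod (s : Multiset ℝ) (x : ℝ) :
    0 ≤ ((derivative (s.map fun a => X - C a).prod).eval x) ^ 2
        - ((s.map fun a => X - C a).prod).eval x
          * (derivative (derivative (s.map fun a => X - C a).prod)).eval x ∧
    (((s.map fun a => X - C a).prod).eval x ≠ 0 → 0 < s.card →
      0 < ((derivative (s.map fun a => X - C a).prod).eval x) ^ 2
        - ((s.map fun a => X - C a).prod).eval x
          * (derivative (derivative (s.map fun a => X - C a).prod)).eval x) := by
  induction s using Multiset.induction_on with
  | empty => simp
  | cons a s ih =>
    simp only [Multiset.map_cons, Multiset.prod_cons]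
    generalize (s.map fun a => X - C a).prod = P at ih
    -- The Laguerre expression `L(P) = P'² - P P''` satisfies `L((X - a) P) = P² + (X - a)² L(P)`.
    have key : ((derivative ((X - C a) * P)).eval x) ^ 2
        - ((X - C a) * P).eval x * (derivative (derivative ((X - C a) * P))).eval x
        = (P.eval x) ^ 2 + (x - a) ^ 2 * (((derivative P).eval x) ^ 2
          - P.eval x * (derivative (derivative P)).eval x) := by
      simp [derivative_mul]; ring
    have h2 : 0 ≤ (x - a) ^ 2 * (((derivative P).eval x) ^ 2
          - P.eval x * (derivative (derivative P)).eval x) := mul_nonneg (sq_nonneg _) ih.1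
    rw [key]
    refine ⟨by positivity, fun h _ => ?_⟩
    have : P.eval x ≠ 0 := by
      rw [eval_mul] at h; exact right_ne_zero_of_mul h
    positivity

theorem Splits.laguerre {p : ℝ[X]} (hp : p.Splits) (x : ℝ) :
    p.eval x * (derivative (derivative p)).eval x ≤ ((derivative p).eval x) ^ 2 := by
  have h := (laguerre_prod p.roots x).1
  rw [hp.eq_prod_roots]
  simp only [derivative_C_mul, eval_mul, eval_C]
  nlinarith [sq_nonneg p.leadingCoeff, mul_nonneg (sq_nonneg p.leadingCoeff) h]

theorem Splits.laguerre_strict {p : ℝ[X]} (hp : p.Splits) (hd : 0 < p.natDegree) {x : ℝ}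
    (hx : p.eval x ≠ 0) :
    p.eval x * (derivative (derivative p)).eval x < ((derivative p).eval x) ^ 2 := by
  have h := (laguerre_prod p.roots x).2
  have hc : p.leadingCoeff ≠ 0 := by
    intro h; rw [leadingCoeff_eq_zero] at h; simp [h] at hd
  have hx' := hx
  rw [hp.eq_prod_roots, eval_mul] at hx'
  have h := h (right_ne_zero_of_mul hx') (by rwa [splits_iff_card_roots.1 hp])
  rw [hp.eq_prod_roots]
  simp only [derivative_C_mul, eval_mul, eval_C]
  have : 0 < p.leadingCoeff ^ 2 := by positivity
  nlinarith [mul_pos this h]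

end Polynomial

/-! ### Newton's inequalities and Gårding's cone. -/

namespace Multiset

open Polynomial

theorem coeff_iterate_derivative_prod_X_add_C (s : Multiset ℝ) {d j k : ℕ}
    (h : d + j + k = s.card) :
    (derivative^[d] (s.map fun a => X + C a).prod).coeff j
      = ((d + j).descFactorial d : ℝ) * s.esymm k := by
  rw [coeff_iterate_derivative, Multiset.prod_X_add_C_coeff s (by omega), nsmul_eq_mul]
  have h1 : s.card - (j + d) = k := by omega
  rw [h1, add_comm j d]

theorem splits_prod_X_add_C (s : Multiset ℝ) : ((s.map fun a => X + C a).prod).Splits := by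
  apply Splits.multisetProd
  intro f hf
  obtain ⟨a, -, rfl⟩ := Multiset.mem_map.1 hf
  exact Splits.X_add_C a

/-- Differentiating `∏ (X + a)` exactly `card - (k + 2)` times keeps it real-rooted and brings
`e_{k+2}, e_{k+1}, e_k` to the three lowest coefficients. Laguerre's inequality at `0` then relates
them. -/
theorem newton_aux (s : Multiset ℝ) {k : ℕ} (hk : k + 2 ≤ s.card) :
    ∃ a b : ℝ, 0 < a ∧ a < b ∧ b * (s.esymm k * s.esymm (k + 2)) ≤ a * s.esymm (k + 1) ^ 2 ∧
      (s.esymm (k + 2) ≠ 0 → b * (s.esymm k * s.esymm (k + 2)) < a * s.esymm (k + 1) ^ 2) := by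
  obtain ⟨d, hd⟩ := Nat.exists_eq_add_of_le hk
  set P := (s.map fun a => X + C a).prod with hP
  set Q := derivative^[d] P with hQ
  have hQs : Q.Splits := (splits_prod_X_add_C s).iterate_derivative_real d
  have c0 : Q.coeff 0 = (d.factorial : ℝ) * s.esymm (k + 2) := by
    rw [hQ, coeff_iterate_derivative_prod_X_add_C s (k := k + 2) (by omega)]
    simp [Nat.descFactorial_self]
  have c1 : Q.coeff 1 = ((d + 1).factorial : ℝ) * s.esymm (k + 1) := by
    rw [hQ, coeff_iterate_derivative_prod_X_add_C s (k := k + 1) (by omega)]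
    congr 2
    have := Nat.factorial_mul_descFactorial (n := d + 1) (k := d) (by omega)
    simpa using this
  have c2 : 2 * Q.coeff 2 = ((d + 2).factorial : ℝ) * s.esymm k := by
    rw [hQ, coeff_iterate_derivative_prod_X_add_C s (k := k) (by omega), ← mul_assoc]
    congr 1
    have := Nat.factorial_mul_descFactorial (n := d + 2) (k := d) (by omega)
    have h2 : d + 2 - d = 2 := by omega
    rw [h2] at this
    exact_mod_cast this
  have e0 : Q.eval 0 = Q.coeff 0 := (coeff_zero_eq_eval_zero Q).symm
  have e1 : (derivative Q).eval 0 = Q.coeff 1 := by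
    rw [← coeff_zero_eq_eval_zero, coeff_derivative]; simp
  have e2 : (derivative (derivative Q)).eval 0 = 2 * Q.coeff 2 := by
    rw [← coeff_zero_eq_eval_zero, coeff_derivative, coeff_derivative]; norm_num; ring
  have hfac : (0 : ℝ) < d.factorial := by exact_mod_cast d.factorial_pos
  have hf1 : ((d + 1).factorial : ℝ) = (d + 1) * d.factorial := by
    rw [Nat.factorial_succ]; push_cast; ring
  have hf2 : ((d + 2).factorial : ℝ) = (d + 2) * ((d + 1) * d.factorial) := by
    rw [Nat.factorial_succ, Nat.factorial_succ]; push_cast; ring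
  have hpos : 0 < (d.factorial : ℝ) ^ 2 * (d + 1) := by positivity
  -- The constants remain after dividing `d! (d+2)! e_k e_{k+2} ≤ ((d+1)! e_{k+1})²` by `(d!)²
  -- (d+1)`.
  refine ⟨d + 1, d + 2, by positivity, by linarith, ?_, fun h => ?_⟩
  · have h := hQs.laguerre 0
    rw [e0, e1, e2, c0, c1, c2, hf1, hf2] at h
    nlinarith
  · have hdeg : 0 < Q.natDegree := by
      by_contra h0
      have : Q.coeff (k + 2) = 0 := coeff_eq_zero_of_natDegree_lt (by omega)
      rw [hQ, coeff_iterate_derivative_prod_X_add_C s (k := 0) (by omega),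
        esymm_zero_right, mul_one] at this
      have h3 : (d + (k + 2)).descFactorial d ≠ 0 := by
        rw [Ne, Nat.descFactorial_eq_zero_iff_lt]; omega
      exact h3 (by exact_mod_cast this)
    have h := hQs.laguerre_strict hdeg (x := 0) (by rw [e0, c0]; positivity)
    rw [e0, e1, e2, c0, c1, c2, hf1, hf2] at h
    nlinarith

/-- A weak form of Newton's inequalities for elementary symmetric functions of real numbers. -/
theorem esymm_mul_esymm_le_sq (s : Multiset ℝ) (k : ℕ) :
    s.esymm k * s.esymm (k + 2) ≤ s.esymm (k + 1) ^ 2 := by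
  rcases le_or_gt (k + 2) s.card with hk | hk
  · obtain ⟨a, b, ha, hab, h, -⟩ := newton_aux s hk
    by_contra! hc
    nlinarith [sq_nonneg (s.esymm (k + 1))]
  · rw [esymm_eq_zero_of_card_lt s hk, mul_zero]; positivity

theorem esymm_mul_esymm_neg (s : Multiset ℝ) {k : ℕ} (h1 : s.esymm (k + 1) = 0)
    (h2 : s.esymm (k + 2) ≠ 0) : s.esymm k * s.esymm (k + 2) < 0 := by
  rcases le_or_gt (k + 2) s.card with hk | hk
  · obtain ⟨a, b, ha, hab, -, h⟩ := newton_aux s hk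
    have h := h h2
    rw [h1] at h
    have hb : 0 < b := ha.trans hab
    by_contra! hc
    nlinarith
  · exact absurd (esymm_eq_zero_of_card_lt s hk) h2

/-- Gårding's cone: the first `m` elementary symmetric functions are positive. -/
def InCone (m : ℕ) (s : Multiset ℝ) : Prop := ∀ k ≤ m, 0 < s.esymm k

theorem InCone.mono {m l : ℕ} {s : Multiset ℝ} (h : InCone m s) (hl : l ≤ m) : InCone l s :=
  fun k hk => h k (hk.trans hl)

/-- Deleting an entry costs one order of positivity. This makes the derivatives of `e_{k+1}` in the
individual entries positive on the cone. -/
theorem InCone.of_cons {m : ℕ} {a : ℝ} {s : Multiset ℝ} (h : InCone (m + 1) (a ::ₘ s)) :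
    InCone m s := by
  induction m with
  | zero =>
    intro k hk
    obtain rfl : k = 0 := by omega
    simp [esymm_zero_right]
  | succ m ih =>
    have ih := ih (h.mono (by omega))
    intro k hk
    rcases Nat.lt_or_ge k (m + 1) with hk' | hk'
    · exact ih k (by omega)
    obtain rfl : k = m + 1 := by omega
    have h1 := h (m + 1) (by omega)
    have h2 := h (m + 2) (by omega)
    rw [esymm_cons_succ] at h1 h2
    have h0 := ih m le_rfl
    have hN := esymm_mul_esymm_le_sq s m
    by_contra! hc
    have ha : 0 < a := by
      by_contra! ha; nlinarith
    -- The two products add up to `e_m e_{m+2} - e_{m+1}² > 0`, which contradicts Newton.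
    nlinarith [mul_pos h0 h2, mul_nonneg (neg_nonneg.2 hc) h1.le]

/-- Where the top elementary symmetric function is positive, the closed cone is open. -/
theorem InCone.of_nonneg {m : ℕ} {s : Multiset ℝ} (h : ∀ k ≤ m, 0 ≤ s.esymm k)
    (hm : 0 < s.esymm m) : InCone m s := by
  induction m with
  | zero =>
    intro k hk
    obtain rfl : k = 0 := by omega
    exact hm
  | succ m ih =>
    intro k hk
    rcases hk.lt_or_eq with hk | rfl
    · refine ih (fun j hj => h j (by omega)) ?_ k (by omega)
      rcases (h m (by omega)).lt_or_eq with h0 | h0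
      · exact h0
      exfalso
      rcases m with _ | l
      · rw [esymm_zero_right] at h0; exact one_ne_zero h0.symm
      -- A vanishing `e_{l+1}` next to `e_{l+2} > 0` would force `e_l < 0`.
      have := esymm_mul_esymm_neg s h0.symm hm.ne'
      have h3 := mul_nonneg (h l (by omega)) hm.le
      linarith
    · exact hm

end Multiset

theorem meanCurv_eq_esymm {n : ℕ} (m : ℕ) (κ : Fin n → ℝ) :
    meanCurv m κ = (Finset.univ.val.map κ).esymm m / (n.choose m : ℝ) := by
  rw [meanCurv, Finset.esymm_map_val]

/-- Gårding's cone is open, contains `(1, …, 1)` and, by `InCone.of_nonneg`, is relatively closed in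
`{H_m > 0}`. It therefore contains the whole component. -/
theorem gammaCone_subset {n m : ℕ} (hmn : m ≤ n) {κ : Fin n → ℝ} (hκ : κ ∈ gammaCone n m) :
    Multiset.InCone m (Finset.univ.val.map κ) := by
  have hch : (0 : ℝ) < n.choose m := by exact_mod_cast Nat.choose_pos hmn
  have hcont : ∀ k, Continuous fun κ : Fin n → ℝ => (Finset.univ.val.map κ).esymm k := by
    intro k
    simp only [Finset.esymm_map_val]
    fun_prop
  have hpos : ∀ κ : Fin n → ℝ, 0 < meanCurv m κ ↔ 0 < (Finset.univ.val.map κ).esymm m := by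
    intro κ
    rw [meanCurv_eq_esymm, div_pos_iff_of_pos_right hch]
  have hone : (fun _ => 1 : Fin n → ℝ) ∈ {κ : Fin n → ℝ | 0 < meanCurv m κ} := by
    by_contra hc
    rw [gammaCone, connectedComponentIn_eq_empty hc] at hκ
    exact hκ
  have hone' : (fun _ => 1 : Fin n → ℝ) ∈
      {κ : Fin n → ℝ | Multiset.InCone m (Finset.univ.val.map κ)} := by
    intro k hk
    rw [Finset.esymm_map_val]
    simpa using Nat.choose_pos (hk.trans hmn)
  have hopen : IsOpen {κ : Fin n → ℝ | Multiset.InCone m (Finset.univ.val.map κ)} := by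
    have : {κ : Fin n → ℝ | Multiset.InCone m (Finset.univ.val.map κ)}
        = ⋂ k ∈ Finset.Iic m, {κ | 0 < (Finset.univ.val.map κ).esymm k} := by
      ext; simp [Multiset.InCone]
    rw [this]
    exact isOpen_biInter_finset fun k _ => isOpen_lt continuous_const (hcont k)
  refine (isPreconnected_connectedComponentIn (F := {κ : Fin n → ℝ | 0 < meanCurv m κ})
    (x := fun _ => 1)).subset_of_closure_inter_subset hopen
    ⟨_, mem_connectedComponentIn hone, hone'⟩ ?_ hκ
  rintro μ ⟨hμ, hμ'⟩
  have hμm : μ ∈ {κ : Fin n → ℝ | 0 < meanCurv m κ} := connectedComponentIn_subset _ _ hμ'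
  refine Multiset.InCone.of_nonneg (fun k hk => ?_) ((hpos μ).1 hμm)
  have hcl : IsClosed {κ : Fin n → ℝ | 0 ≤ (Finset.univ.val.map κ).esymm k} :=
    isClosed_le continuous_const (hcont k)
  exact closure_minimal (fun κ' h => (h k hk).le) hcl hμ

/-! ### Effect of a rank-one perturbation on elementary symmetric functions. -/

section RankOne

open Polynomial

/-- Compare coefficients in `x`. The identity is only needed off the points `κ i`, where the
determinant formula below can be proved by inverting the diagonal matrix. -/
theorem esymm_eq_add_of_prod_eq {n : ℕ} {κ μ a : Fin n → ℝ}
    (h : ∀ x, (∀ i, κ i - x ≠ 0) → ∏ i, (μ i - x)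
      = ∏ i, (κ i - x) + ∑ i, a i * ∏ j ∈ Finset.univ.erase i, (κ j - x))
    {k : ℕ} (hk : k + 1 ≤ n) :
    (Finset.univ.val.map μ).esymm (k + 1) = (Finset.univ.val.map κ).esymm (k + 1)
      + ∑ i, a i * ((Finset.univ.erase i).val.map κ).esymm k := by
  have hP : ∏ i, (X + C (μ i)) = ∏ i, (X + C (κ i))
      + ∑ i, C (a i) * ∏ j ∈ Finset.univ.erase i, (X + C (κ j)) := by
    apply Polynomial.eq_of_infinite_eval_eq
    refine (Set.Finite.infinite_compl (Set.finite_range fun i => -κ i)).mono fun x hx => ?_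
    have := h (-x) fun i hi => hx ⟨i, by dsimp only; linarith⟩
    simpa [eval_prod, eval_finsetSum, add_comm] using this
  have hprod : ∀ (s : Finset (Fin n)) (f : Fin n → ℝ),
      ∏ i ∈ s, (X + C (f i)) = ((s.val.map f).map fun r => X + C r).prod := by
    intro s f; rw [Multiset.map_map]; rfl
  have hc := congrArg (fun p => p.coeff (n - (k + 1))) hP
  simp only [coeff_add, finsetSum_coeff, coeff_C_mul, hprod] at hc
  rw [Multiset.prod_X_add_C_coeff _ (by simp), Multiset.prod_X_add_C_coeff _ (by simp)] at hc
  have e1 : n - (n - (k + 1)) = k + 1 := by omega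
  simp only [Multiset.card_map, Finset.card_val, Finset.card_univ, Fintype.card_fin, e1] at hc
  rw [hc]
  congr 1
  refine Finset.sum_congr rfl fun i _ => ?_
  have hcard : (Finset.univ.erase i).card = n - 1 := by simp
  rw [Multiset.prod_X_add_C_coeff _ (by simp; omega)]
  congr 2
  simp only [Multiset.card_map, Finset.card_val, hcard]
  omega

end RankOne

/-! ### Monotonicity of the elementary symmetric functions of eigenvalues. -/

namespace Matrix

variable {n : ℕ}

theorem det_diagonal_add_vecMulVec {d : Fin n → ℝ} (hd : ∀ i, d i ≠ 0) (w : Fin n → ℝ) :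
    (diagonal d + vecMulVec w w).det
      = ∏ i, d i + ∑ i, w i ^ 2 * ∏ j ∈ Finset.univ.erase i, d j := by
  have hu : IsUnit (diagonal d).det := by
    rw [det_diagonal, isUnit_iff_ne_zero]; exact Finset.prod_ne_zero_iff.2 fun i _ => hd i
  have hinv : (diagonal d)⁻¹ = diagonal fun i => (d i)⁻¹ := by
    apply inv_eq_left_inv
    rw [diagonal_mul_diagonal, ← diagonal_one]
    congr 1; ext i; exact inv_mul_cancel₀ (hd i)
  have h1 : (1 + replicateRow Unit w * (diagonal d)⁻¹ * replicateCol Unit w).det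
      = 1 + ∑ i, w i * (d i)⁻¹ * w i := by
    rw [det_unique, hinv]
    rw [add_apply, Matrix.mul_apply]
    simp [mul_diagonal]
  rw [vecMulVec_eq Unit, det_add_replicateCol_mul_replicateRow hu, det_diagonal, h1, mul_add,
    mul_one, Finset.mul_sum]
  congr 1
  refine Finset.sum_congr rfl fun i _ => ?_
  rw [← Finset.mul_prod_erase Finset.univ d (Finset.mem_univ i)]
  have := hd i
  field_simp

theorem charpoly_roots_eq_of_det {B : Matrix (Fin n) (Fin n) ℝ} {κ : Fin n → ℝ}
    (h : ∀ x : ℝ, (B - x • (1 : Matrix (Fin n) (Fin n) ℝ)).det = ∏ i, (κ i - x)) :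
    B.charpoly.roots = Finset.univ.val.map κ := by
  have hc : B.charpoly = ∏ i, (Polynomial.X - Polynomial.C (κ i)) := by
    apply Polynomial.funext
    intro x
    rw [eval_charpoly, Polynomial.eval_prod]
    have e : scalar (Fin n) x - B = -(B - x • (1 : Matrix (Fin n) (Fin n) ℝ)) := by
      rw [neg_sub, smul_one_eq_diagonal]; rfl
    rw [e, det_neg, h]
    simp only [Polynomial.eval_sub, Polynomial.eval_X, Polynomial.eval_C]
    rw [← Finset.card_univ, ← Finset.prod_const, ← Finset.prod_mul_distrib]
    exact Finset.prod_congr rfl fun i _ => by ring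
  rw [hc, Polynomial.roots_prod]
  · simp
  · simp [Finset.prod_ne_zero_iff, Polynomial.X_sub_C_ne_zero]

theorem IsHermitian.det_sub_smul_one {B : Matrix (Fin n) (Fin n) ℝ} (hB : B.IsHermitian) (x : ℝ) :
    (B - x • (1 : Matrix (Fin n) (Fin n) ℝ)).det = ∏ i, (hB.eigenvalues i - x) := by
  have h := congrArg (Polynomial.eval x) hB.charpoly_eq
  rw [eval_charpoly, Polynomial.eval_prod] at h
  have e : B - x • (1 : Matrix (Fin n) (Fin n) ℝ) = -(scalar (Fin n) x - B) := by
    rw [neg_sub, smul_one_eq_diagonal]; rfl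
  rw [e, det_neg, h, ← Finset.card_univ, ← Finset.prod_const, ← Finset.prod_mul_distrib]
  exact Finset.prod_congr rfl fun i _ => by simp

theorem IsHermitian.exists_diagonalization {B : Matrix (Fin n) (Fin n) ℝ} (hB : B.IsHermitian) :
    ∃ U : Matrix (Fin n) (Fin n) ℝ, U * Uᵀ = 1 ∧ B = U * diagonal hB.eigenvalues * Uᵀ := by
  refine ⟨hB.eigenvectorUnitary, ?_, ?_⟩
  · have := Unitary.coe_mul_star_self hB.eigenvectorUnitary
    rwa [Unitary.coe_star, star_eq_conjTranspose, conjTranspose_eq_transpose_of_trivial] at this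
  · have := hB.spectral_theorem
    rw [Unitary.conjStarAlgAut_apply, star_eq_conjTranspose,
      conjTranspose_eq_transpose_of_trivial] at this
    exact this

theorem isHermitian_vecMulVec_self (w : Fin n → ℝ) : (vecMulVec w w).IsHermitian := by
  ext i j; simp [vecMulVec_apply, mul_comm]

/-- A rank-one positive perturbation increases the elementary symmetric functions of the
eigenvalues on Gårding's cone. -/
theorem IsHermitian.esymm_charpoly_roots_add_vecMulVec {B : Matrix (Fin n) (Fin n) ℝ}
    (hB : B.IsHermitian) (w : Fin n → ℝ) {m k : ℕ} (hm : Multiset.InCone m B.charpoly.roots)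
    (hk : k + 1 ≤ m) :
    B.charpoly.roots.esymm (k + 1) ≤ (B + vecMulVec w w).charpoly.roots.esymm (k + 1) ∧
    (w ≠ 0 →
      B.charpoly.roots.esymm (k + 1) < (B + vecMulVec w w).charpoly.roots.esymm (k + 1)) := by
  have hC := hB.add (isHermitian_vecMulVec_self w)
  obtain ⟨U, hU, hBU⟩ := hB.exists_diagonalization
  -- In an eigenbasis of `B` the perturbation is `v vᵀ` with `v = Uᵀ w`, so `e_{k+1}` grows by `∑
  -- vᵢ² e_k(κ without κᵢ)`.
  have hU' : Uᵀ * U = 1 := mul_eq_one_comm.1 hU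
  rw [charpoly_roots_eq_of_det hB.det_sub_smul_one] at hm ⊢
  rw [charpoly_roots_eq_of_det hC.det_sub_smul_one]
  set κ := hB.eigenvalues
  set v := Uᵀ *ᵥ w with hv
  have hw : U *ᵥ v = w := by rw [hv, mulVec_mulVec, hU, one_mulVec]
  have hkn : k + 1 ≤ n := by
    by_contra hlt
    have := hm (k + 1) hk
    rw [Multiset.esymm_eq_zero_of_card_lt _ (by simpa using hlt)] at this
    exact lt_irrefl _ this
  have hsum := esymm_eq_add_of_prod_eq (κ := κ) (μ := hC.eigenvalues) (a := fun i => v i ^ 2)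
    (fun x hx => by
      rw [← det_diagonal_add_vecMulVec hx, ← hC.det_sub_smul_one]
      have e : B + vecMulVec w w - x • (1 : Matrix (Fin n) (Fin n) ℝ)
          = U * (diagonal (fun i => κ i - x) + vecMulVec v v) * Uᵀ := by
        have e1 : diagonal (fun i => κ i - x)
            = diagonal κ - x • (1 : Matrix (Fin n) (Fin n) ℝ) := by
          rw [smul_one_eq_diagonal, diagonal_sub]
        rw [e1, mul_add, add_mul, mul_sub, sub_mul, ← hBU, mul_vecMulVec, vecMulVec_mul, hw,
          vecMul_transpose, hw, mul_smul_comm, smul_mul_assoc, mul_one, hU]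
        abel
      rw [e, det_mul, det_mul, mul_right_comm, ← det_mul, hU, det_one, one_mul]) hkn
  have hpos : ∀ i, 0 < ((Finset.univ.erase i).val.map κ).esymm k := by
    intro i
    have e : Finset.univ.val.map κ = κ i ::ₘ (Finset.univ.erase i).val.map κ := by
      rw [← Multiset.map_cons, Finset.erase_val, Multiset.cons_erase (Finset.mem_univ_val i)]
    rw [e] at hm
    obtain ⟨m, rfl⟩ : ∃ m', m = m' + 1 := ⟨m - 1, by omega⟩
    exact hm.of_cons k (by omega)
  have hnn : ∀ i, 0 ≤ v i ^ 2 * ((Finset.univ.erase i).val.map κ).esymm k :=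
    fun i => mul_nonneg (sq_nonneg _) (hpos i).le
  rw [hsum]
  refine ⟨le_add_of_nonneg_right (Finset.sum_nonneg fun i _ => hnn i), fun hw0 => ?_⟩
  have hv0 : ∃ i, v i ≠ 0 := by
    by_contra! h0
    have : v = 0 := funext h0
    rw [this, mulVec_zero] at hw
    exact hw0 hw.symm
  obtain ⟨i, hi⟩ := hv0
  exact lt_add_of_pos_right _ (Finset.sum_pos' (fun i _ => hnn i)
    ⟨i, Finset.mem_univ i, mul_pos (by positivity) (hpos i)⟩)

theorem IsHermitian.inCone_add_vecMulVec {B : Matrix (Fin n) (Fin n) ℝ}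
    (hB : B.IsHermitian) (w : Fin n → ℝ) {m : ℕ} (hm : Multiset.InCone m B.charpoly.roots) :
    Multiset.InCone m (B + vecMulVec w w).charpoly.roots := by
  rintro (_ | k) hk
  · simp [Multiset.esymm_zero_right]
  · exact (hm _ hk).trans_le (hB.esymm_charpoly_roots_add_vecMulVec w hm hk).1

theorem IsHermitian.esymm_charpoly_roots_le_add_sum {ι : Type*} {B : Matrix (Fin n) (Fin n) ℝ}
    (hB : B.IsHermitian) (w : ι → Fin n → ℝ) (s : Finset ι) {m : ℕ}
    (hm : Multiset.InCone m B.charpoly.roots) {k : ℕ} (hk : k + 1 ≤ m) :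
    B.charpoly.roots.esymm (k + 1)
      ≤ (B + ∑ i ∈ s, vecMulVec (w i) (w i)).charpoly.roots.esymm (k + 1) := by
  classical
  induction s using Finset.induction_on generalizing B with
  | empty => simp
  | insert a s ha ih =>
    rw [Finset.sum_insert ha, ← add_assoc]
    exact (hB.esymm_charpoly_roots_add_vecMulVec (w a) hm hk).1.trans
      (ih (hB.add (isHermitian_vecMulVec_self _)) (hB.inCone_add_vecMulVec (w a) hm))

theorem IsHermitian.esymm_charpoly_roots_lt_add_posDef {B P : Matrix (Fin n) (Fin n) ℝ}
    (hB : B.IsHermitian) (hP : P.PosDef) {m : ℕ}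
    (hm : Multiset.InCone m B.charpoly.roots) {k : ℕ} (hk : k + 1 ≤ m) :
    B.charpoly.roots.esymm (k + 1) < (B + P).charpoly.roots.esymm (k + 1) := by
  obtain ⟨l, w, hw⟩ := posSemidef_iff_eq_sum_vecMulVec.1 hP.posSemidef
  simp only [star_trivial] at hw
  have hn : 0 < n := by
    rcases n.eq_zero_or_pos with rfl | h
    · have := hm (k + 1) hk
      rw [charpoly_roots_eq_of_det hB.det_sub_smul_one,
        Multiset.esymm_eq_zero_of_card_lt _ (by simp)] at this
      exact absurd this (lt_irrefl _)
    · exact h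
  have : ∃ i, w i ≠ 0 := by
    by_contra! h
    have h0 : P = 0 := by rw [hw]; simp [h]
    have : NeZero n := ⟨hn.ne'⟩
    have := hP.diag_pos (i := 0)
    simp [h0] at this
  obtain ⟨i, hi⟩ := this
  -- A nonzero rank-one summand goes first and gives the strict increase. The result stays in the
  -- cone, so the other summands cannot undo it.
  rw [hw, ← Finset.add_sum_erase _ _ (Finset.mem_univ i), ← add_assoc]
  exact ((hB.esymm_charpoly_roots_add_vecMulVec (w i) hm hk).2 hi).trans_le
    ((hB.add (isHermitian_vecMulVec_self _)).esymm_charpoly_roots_le_add_sum w _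
      (hB.inCone_add_vecMulVec (w i) hm) hk)

theorem PosDef.exists_isUnit_transpose_mul_mul {g : Matrix (Fin n) (Fin n) ℝ} (hg : g.PosDef) :
    ∃ L : Matrix (Fin n) (Fin n) ℝ, IsUnit L ∧ Lᵀ * g * L = 1 := by
  obtain ⟨U, hU, hgU⟩ := hg.isHermitian.exists_diagonalization
  have hU' : Uᵀ * U = 1 := mul_eq_one_comm.1 hU
  set d := hg.isHermitian.eigenvalues with hd
  have hdpos : ∀ i, 0 < d i := hg.eigenvalues_pos
  have key : (U * diagonal fun i => (Real.sqrt (d i))⁻¹)ᵀ * g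
      * (U * diagonal fun i => (Real.sqrt (d i))⁻¹) = 1 := by
    set D := diagonal fun i => (Real.sqrt (d i))⁻¹
    rw [hgU, transpose_mul, diagonal_transpose]
    calc D * Uᵀ * (U * diagonal d * Uᵀ) * (U * D)
        = D * (Uᵀ * U) * diagonal d * (Uᵀ * U) * D := by simp only [mul_assoc]
      _ = 1 := by
        rw [hU', mul_one, mul_one, diagonal_mul_diagonal, diagonal_mul_diagonal, ← diagonal_one]
        congr 1; ext i
        have h1 := Real.sqrt_pos.2 (hdpos i)
        have h2 := Real.mul_self_sqrt (hdpos i).le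
        field_simp
        nlinarith
  exact ⟨_, IsUnit.of_mul_eq_one_right _ key, key⟩

theorem esymm_map_mul_left (c : ℝ) (κ : Fin n → ℝ) (k : ℕ) :
    (Finset.univ.val.map fun i => c * κ i).esymm k = c ^ k * (Finset.univ.val.map κ).esymm k := by
  rw [Finset.esymm_map_val, Finset.esymm_map_val, Finset.mul_sum]
  refine Finset.sum_congr rfl fun s hs => ?_
  rw [Finset.prod_mul_distrib, Finset.prod_const, (Finset.mem_powersetCard.1 hs).2]

/-- Strict monotonicity of the elementary symmetric functions of the eigenvalues of a pencil
`B - x g`, on Gårding's cone. -/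
theorem esymm_lt_of_posDef_sub {g B₁ B₂ : Matrix (Fin n) (Fin n) ℝ} (hg : g.PosDef)
    (hB₂ : B₂.IsHermitian) (hP : (B₁ - B₂).PosDef) {μ₁ μ₂ : Fin n → ℝ}
    (h₁ : ∀ x : ℝ, (B₁ - x • g).det = g.det * ∏ i, (μ₁ i - x))
    (h₂ : ∀ x : ℝ, (B₂ - x • g).det = g.det * ∏ i, (μ₂ i - x)) {m : ℕ} (hm : 1 ≤ m)
    (hc : Multiset.InCone m (Finset.univ.val.map μ₂)) :
    (Finset.univ.val.map μ₂).esymm m < (Finset.univ.val.map μ₁).esymm m := by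
  -- Congruence by `L` turns the pencil `B - x g` into an ordinary eigenvalue problem and preserves
  -- positive definiteness.
  obtain ⟨L, hLu, hL⟩ := hg.exists_isUnit_transpose_mul_mul
  have hdet : Lᵀ.det * g.det * L.det = 1 := by rw [← det_mul, ← det_mul, hL, det_one]
  have hroots : ∀ {B : Matrix (Fin n) (Fin n) ℝ} {μ : Fin n → ℝ},
      (∀ x : ℝ, (B - x • g).det = g.det * ∏ i, (μ i - x)) →
      (Lᵀ * B * L).charpoly.roots = Finset.univ.val.map μ := by
    intro B μ h
    apply charpoly_roots_eq_of_det
    intro x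
    have e : Lᵀ * B * L - x • (1 : Matrix (Fin n) (Fin n) ℝ) = Lᵀ * (B - x • g) * L := by
      rw [mul_sub, sub_mul, mul_smul_comm, smul_mul_assoc, hL]
    rw [e, det_mul, det_mul, h x]
    linear_combination (∏ i, (μ i - x)) * hdet
  have hsum : Lᵀ * B₁ * L = Lᵀ * B₂ * L + Lᵀ * (B₁ - B₂) * L := by
    rw [mul_sub, sub_mul]; abel
  obtain ⟨m, rfl⟩ : ∃ m', m = m' + 1 := ⟨m - 1, by omega⟩
  have hH : (Lᵀ * B₂ * L).IsHermitian := by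
    have := isHermitian_conjTranspose_mul_mul L hB₂
    rwa [conjTranspose_eq_transpose_of_trivial] at this
  have hPD : (Lᵀ * (B₁ - B₂) * L).PosDef := by
    have := hP.conjTranspose_mul_mul_same (B := L) (mulVec_injective_of_isUnit hLu)
    rwa [conjTranspose_eq_transpose_of_trivial] at this
  rw [← hroots h₁, hsum, ← hroots h₂]
  exact hH.esymm_charpoly_roots_lt_add_posDef hPD (by rwa [hroots h₂]) le_rfl

end Matrix

/-! ### Second derivative test and the function `log (tanh (t / 2))`. -/

section Calculus

variable {V : Type*} [NormedAddCommGroup V] [NormedSpace ℝ V]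

/-- At a local maximum the second derivative is negative semidefinite. -/
theorem IsLocalMax.fderiv_fderiv_nonpos {φ : V → ℝ} {y : V} (h : IsLocalMax φ y)
    (hφ : ContDiff ℝ 2 φ) (ξ : V) : fderiv ℝ (fderiv ℝ φ) y ξ ξ ≤ 0 := by
  have hline : ∀ t : ℝ, HasDerivAt (fun t : ℝ => y + t • ξ) ξ t := fun t => by
    simpa using ((hasDerivAt_id t).smul_const ξ).const_add y
  have hd1 : ∀ t : ℝ, HasDerivAt (fun t : ℝ => φ (y + t • ξ)) (fderiv ℝ φ (y + t • ξ) ξ) t :=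
    fun t => ((hφ.differentiable (by norm_num)) _).hasFDerivAt.comp_hasDerivAt t (hline t)
  have hderiv : deriv (fun t : ℝ => φ (y + t • ξ)) = fun t => fderiv ℝ φ (y + t • ξ) ξ :=
    funext fun t => (hd1 t).deriv
  have hφ' : ContDiff ℝ 1 (fderiv ℝ φ) := hφ.fderiv_right (by norm_num)
  have hd2 : HasDerivAt (fun t : ℝ => fderiv ℝ φ (y + t • ξ) ξ)
      (fderiv ℝ (fderiv ℝ φ) y ξ ξ) 0 := by
    have h0 : HasFDerivAt (fderiv ℝ φ) (fderiv ℝ (fderiv ℝ φ) y) y :=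
      ((hφ'.differentiable (by norm_num)) y).hasFDerivAt
    have h1 : HasFDerivAt (fun w => fderiv ℝ φ w ξ) ((fderiv ℝ (fderiv ℝ φ) y).flip ξ)
        (y + (0 : ℝ) • ξ) := by
      rw [zero_smul, add_zero]
      exact (ContinuousLinearMap.apply ℝ ℝ ξ).hasFDerivAt.comp y h0
    exact h1.comp_hasDerivAt (0 : ℝ) (hline 0)
  have hmax : IsLocalMax (fun t : ℝ => φ (y + t • ξ)) 0 := by
    have hc : Filter.Tendsto (fun t : ℝ => y + t • ξ) (nhds 0) (nhds y) := by
      simpa using (hline 0).continuousAt.tendsto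
    have := hc.eventually h
    simpa [IsLocalMax, IsMaxFilter] using this
  -- A positive second derivative would make `0` also a local minimum on the line, so the
  -- restriction would be locally constant.
  by_contra! hpos
  have hmin := isLocalMin_of_deriv_deriv_pos (f := fun t : ℝ => φ (y + t • ξ)) (x₀ := 0)
    (by rw [hderiv, hd2.deriv]; exact hpos) hmax.deriv_eq_zero (hd1 0).continuousAt
  have heq : (fun t : ℝ => φ (y + t • ξ)) =ᶠ[nhds 0] fun _ => φ (y + (0 : ℝ) • ξ) := by
    filter_upwards [hmax, hmin] with t h1 h2 using le_antisymm h1 h2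
  have := heq.deriv.deriv_eq
  rw [hderiv, hd2.deriv] at this
  simp at this
  exact hpos.ne' this

theorem Real.hasDerivAt_log_tanh_half {t : ℝ} (ht : 0 < t) :
    HasDerivAt (fun t => Real.log (Real.tanh (t / 2))) (Real.sinh t)⁻¹ t := by
  have hs : 0 < Real.sinh (t / 2) := Real.sinh_pos_iff.2 (by linarith)
  have hc : 0 < Real.cosh (t / 2) := Real.cosh_pos _
  have h2 : HasDerivAt (fun t : ℝ => t / 2) (1 / 2) t := (hasDerivAt_id t).div_const 2
  have h1 := (h2.sinh.div h2.cosh hc.ne').log (div_pos hs hc).ne'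
  have e : (fun t : ℝ => Real.log (Real.tanh (t / 2)))
      = fun t => Real.log (Real.sinh (t / 2) / Real.cosh (t / 2)) := by
    ext t; rw [Real.tanh_eq_sinh_div_cosh]
  rw [e]
  refine h1.congr_deriv ?_
  have h3 : Real.sinh t = 2 * Real.sinh (t / 2) * Real.cosh (t / 2) := by
    rw [← Real.sinh_two_mul]; congr 1; ring
  rw [h3]
  have h4 := Real.cosh_sq (t / 2)
  simp only [Pi.div_apply]
  field_simp
  linarith

theorem contDiff_log_tanh_half_comp {f : V → ℝ} (hf : ContDiff ℝ 2 f) (hpos : ∀ y, 0 < f y) :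
    ContDiff ℝ 2 fun y => Real.log (Real.tanh (f y / 2)) := by
  have e : (fun y => Real.log (Real.tanh (f y / 2)))
      = fun y => Real.log (Real.sinh (f y / 2) / Real.cosh (f y / 2)) := by
    ext t; rw [Real.tanh_eq_sinh_div_cosh]
  rw [e]
  have hs : ∀ y, 0 < Real.sinh (f y / 2) := fun y => Real.sinh_pos_iff.2 (by linarith [hpos y])
  have h2 : ContDiff ℝ 2 fun y => f y / 2 := hf.div_const 2
  refine ContDiff.log (h2.sinh.div h2.cosh fun y => (Real.cosh_pos _).ne') fun y => ?_
  exact (div_pos (hs y) (Real.cosh_pos _)).ne'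

theorem fderiv_log_tanh_half_comp {f : V → ℝ} {y : V} (hf : DifferentiableAt ℝ f y)
    (hpos : 0 < f y) :
    fderiv ℝ (fun y => Real.log (Real.tanh (f y / 2))) y
      = (Real.sinh (f y))⁻¹ • fderiv ℝ f y :=
  ((Real.hasDerivAt_log_tanh_half hpos).comp_hasFDerivAt y hf.hasFDerivAt).fderiv

theorem fderiv_fderiv_log_tanh_half_comp {f : V → ℝ} (hf : ContDiff ℝ 2 f) (hpos : ∀ y, 0 < f y)
    (y ξ η : V) :
    fderiv ℝ (fderiv ℝ fun y => Real.log (Real.tanh (f y / 2))) y ξ η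
      = (Real.sinh (f y))⁻¹ * fderiv ℝ (fderiv ℝ f) y ξ η
        - Real.cosh (f y) / Real.sinh (f y) ^ 2 * (fderiv ℝ f y ξ * fderiv ℝ f y η) := by
  have hd : Differentiable ℝ f := hf.differentiable (by norm_num)
  have e : (fderiv ℝ fun y => Real.log (Real.tanh (f y / 2)))
      = fun y => (Real.sinh (f y))⁻¹ • fderiv ℝ f y :=
    funext fun y => fderiv_log_tanh_half_comp (hd y) (hpos y)
  have hs : 0 < Real.sinh (f y) := Real.sinh_pos_iff.2 (hpos y)
  have h1 : HasFDerivAt (fun y => (Real.sinh (f y))⁻¹) _ y :=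
    (((Real.hasDerivAt_sinh (f y)).inv hs.ne').comp_hasFDerivAt y (hd y).hasFDerivAt)
  have hf' : ContDiff ℝ 1 (fderiv ℝ f) := hf.fderiv_right (by norm_num)
  have h2 : HasFDerivAt (fun y => (Real.sinh (f y))⁻¹ • fderiv ℝ f y) _ y :=
    h1.smul (hf'.differentiable (by norm_num) y).hasFDerivAt
  rw [e, h2.fderiv]
  simp
  ring

end Calculus

/-! ### Stereographic charts of the sphere. -/

section Chart

variable {n : ℕ}

theorem contDiff_coe_chartAt_symm (u : UnitSphere n) :
    ContDiff ℝ ∞ fun w => ((chartAt (EucSp n) u).symm w : EucSp (n + 1)) := by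
  have := Fact.mk (@finrank_euclideanSpace_fin ℝ _ (n + 1))
  have h : ∀ w, ((chartAt (EucSp n) u).symm w : EucSp (n + 1)) = _ :=
    fun w => stereographic'_symm_apply (-u) w
  simp only [h]
  let U := (OrthonormalBasis.fromOrthogonalSpanSingleton (𝕜 := ℝ) n
    (ne_zero_of_mem_unit_sphere (-u))).repr
  have hU : ContDiff ℝ ∞ fun w : EucSp n => ((U.symm w : _) : EucSp (n + 1)) :=
    (Submodule.subtypeL _).contDiff.comp U.symm.contDiff
  have hq := hU.norm_sq ℝ
  have hi := (hq.add (contDiff_const (c := (4 : ℝ)))).inv fun w => by positivity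
  exact (hi.smul (hU.const_smul (4 : ℝ))).add
    (hi.smul ((hq.sub contDiff_const).smul contDiff_const))

theorem chartAt_target_eq_univ (u : UnitSphere n) : (chartAt (EucSp n) u).target = Set.univ :=
  have := Fact.mk (@finrank_euclideanSpace_fin ℝ _ (n + 1))
  stereographic'_target (-u)

theorem contDiff_comp_chartAt_symm {z : UnitSphere n → ℝ} (hz : ContMDiff (𝓡 n) 𝓘(ℝ, ℝ) 2 z)
    (u : UnitSphere n) : ContDiff ℝ 2 fun y => z ((chartAt (EucSp n) u).symm y) := by
  have h1 : ContMDiffOn (𝓡 n) (𝓡 n) 2 (chartAt (EucSp n) u).symm (chartAt (EucSp n) u).target :=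
    contMDiffOn_chart_symm
  rw [chartAt_target_eq_univ, contMDiffOn_univ] at h1
  exact (hz.comp h1).contDiff

/-- Stereographic projection extends to an open set of the ambient space, giving a differentiable
left inverse `G`; the chain rule finishes. Injectivity makes `sphereMetric` positive definite. -/
theorem fderiv_coe_chartAt_symm_injective (u : UnitSphere n) (y : EucSp n) :
    Function.Injective
      (fderiv ℝ (fun w => ((chartAt (EucSp n) u).symm w : EucSp (n + 1))) y) := by
  have := Fact.mk (@finrank_euclideanSpace_fin ℝ _ (n + 1))
  set e := chartAt (EucSp n) u with he
  have hF := ((contDiff_coe_chartAt_symm u).differentiable (by norm_num) y).hasFDerivAt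
  let U := (OrthonormalBasis.fromOrthogonalSpanSingleton (𝕜 := ℝ) n
        (ne_zero_of_mem_unit_sphere (-u))).repr
  let G : EucSp (n + 1) → EucSp n := fun x => U (stereoToFun ((-u : UnitSphere n) : EucSp (n + 1)) x)
  have hy : y ∈ e.target := by rw [he, chartAt_target_eq_univ]; trivial
  have hGF : ∀ w, G (e.symm w : EucSp (n + 1)) = w := fun w =>
    e.right_inv (by rw [he, chartAt_target_eq_univ]; trivial)
  have hsrc : e.symm y ≠ -u := by
    have h1 := e.map_target hy
    have h2 : e.source = {-u}ᶜ := stereographic'_source (-u)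
    rw [h2] at h1
    exact h1
  have hG : DifferentiableAt ℝ G (e.symm y : EucSp (n + 1)) := by
    have hst : DifferentiableAt ℝ (stereoToFun ((-u : UnitSphere n) : EucSp (n + 1)))
        (e.symm y : EucSp (n + 1)) := by
      refine (contDiffOn_stereoToFun (n := 1)).differentiableOn (by norm_num) |>.differentiableAt
        (IsOpen.mem_nhds ?_ ?_)
      · exact isOpen_ne_fun (by fun_prop) continuous_const
      · intro h
        rw [innerSL_apply_apply] at h
        exact hsrc ((sphere_ext_iff _ _).2 h).symm
    exact U.toContinuousLinearEquiv.differentiableAt.comp _ hst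
  have hcomp := hG.hasFDerivAt.comp y hF
  have hid : G ∘ (fun w => (e.symm w : EucSp (n + 1))) = id := funext hGF
  rw [hid] at hcomp
  have hu := hcomp.unique (hasFDerivAt_id y)
  intro a b hab
  have ha := DFunLike.congr_fun hu a
  have hb := DFunLike.congr_fun hu b
  simp only [ContinuousLinearMap.comp_apply, ContinuousLinearMap.id_apply] at ha hb
  rw [← ha, ← hb, hab]

end Chart

/-! ### Fundamental forms of a radial graph in the logarithmic coordinate. -/

section Forms

variable {n : ℕ}

theorem sphereMetric_comm (e : OpenPartialHomeomorph (UnitSphere n) (EucSp n))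
    (y ξ η : EucSp n) : sphereMetric e y ξ η = sphereMetric e y η ξ :=
  real_inner_comm _ _

theorem sphereMetric_smul_right (e : OpenPartialHomeomorph (UnitSphere n) (EucSp n))
    (c : ℝ) (y ξ η : EucSp n) : sphereMetric e y ξ (c • η) = c * sphereMetric e y ξ η := by
  simp [sphereMetric, inner_smul_right]

theorem sphereMetric_sub_right (e : OpenPartialHomeomorph (UnitSphere n) (EucSp n))
    (y ξ η ζ : EucSp n) :
    sphereMetric e y ξ (η - ζ) = sphereMetric e y ξ η - sphereMetric e y ξ ζ := by
  simp [sphereMetric, inner_sub_right]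

theorem sphereMetric_self_pos {e : OpenPartialHomeomorph (UnitSphere n) (EucSp n)}
    {y : EucSp n} (he : Function.Injective (fderiv ℝ (fun w => (e.symm w : EucSp (n + 1))) y))
    {ξ : EucSp n} (hξ : ξ ≠ 0) : 0 < sphereMetric e y ξ ξ :=
  real_inner_self_pos.2 fun h => hξ (he (by rw [h, map_zero]))

theorem differentiable_sphereMetric {e : OpenPartialHomeomorph (UnitSphere n) (EucSp n)}
    (he : ContDiff ℝ ∞ fun w => (e.symm w : EucSp (n + 1))) (ξ η : EucSp n) :
    Differentiable ℝ fun y => sphereMetric e y ξ η := by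
  have h : Differentiable ℝ (fderiv ℝ fun w => (e.symm w : EucSp (n + 1))) :=
    (he.fderiv_right (m := 1) (by norm_cast)).differentiable (by norm_num)
  exact (h.clm_apply (differentiable_const ξ)).inner ℝ (h.clm_apply (differentiable_const η))

theorem christoffelOne_sphereMetric_comm (e : OpenPartialHomeomorph (UnitSphere n) (EucSp n))
    (y ξ η ζ : EucSp n) : christoffelOne (sphereMetric e) y ξ η ζ
      = christoffelOne (sphereMetric e) y η ξ ζ := by
  unfold christoffelOne
  simp only [sphereMetric_comm e _ ξ η]
  ring

theorem christoffelOne_sphereMetric_smul {e : OpenPartialHomeomorph (UnitSphere n) (EucSp n)}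
    (he : ContDiff ℝ ∞ fun w => (e.symm w : EucSp (n + 1)))
    (c : ℝ) (y ξ η ζ : EucSp n) : christoffelOne (sphereMetric e) y ξ η (c • ζ)
      = c * christoffelOne (sphereMetric e) y ξ η ζ := by
  unfold christoffelOne
  simp only [sphereMetric_smul_right]
  rw [fderiv_const_mul (differentiable_sphereMetric he _ _ y),
    fderiv_const_mul (differentiable_sphereMetric he _ _ y)]
  simp
  ring

theorem fderiv_hyperbolicMetric {e : OpenPartialHomeomorph (UnitSphere n) (EucSp n)}
    (he : ContDiff ℝ ∞ fun w => (e.symm w : EucSp (n + 1))) (p X Y Z : EucSp n × ℝ) :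
    fderiv ℝ (fun q => hyperbolicMetric e q Y Z) p X
      = 2 * Real.sinh p.2 * Real.cosh p.2 * X.2 * sphereMetric e p.1 Y.1 Z.1
        + Real.sinh p.2 ^ 2 * fderiv ℝ (fun y => sphereMetric e y Y.1 Z.1) p.1 X.1 := by
  have h1 : HasFDerivAt (fun q : EucSp n × ℝ => sphereMetric e q.1 Y.1 Z.1) _ p :=
    (differentiable_sphereMetric he Y.1 Z.1 p.1).hasFDerivAt.comp p hasFDerivAt_fst
  have h2 : HasFDerivAt (fun q : EucSp n × ℝ => Real.sinh q.2 ^ 2) _ p :=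
    ((Real.hasDerivAt_sinh p.2).pow 2).comp_hasFDerivAt p
      (hasFDerivAt_snd (𝕜 := ℝ) (E := EucSp n) (F := ℝ))
  have h3 : HasFDerivAt (fun q => hyperbolicMetric e q Y Z) _ p := (h2.mul h1).const_add (Y.2 * Z.2)
  rw [h3.fderiv]
  simp
  ring

theorem christoffelOne_hyperbolicMetric {e : OpenPartialHomeomorph (UnitSphere n) (EucSp n)}
    (he : ContDiff ℝ ∞ fun w => (e.symm w : EucSp (n + 1))) (p X Y Z : EucSp n × ℝ) :
    christoffelOne (hyperbolicMetric e) p X Y Z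
      = Real.sinh p.2 * Real.cosh p.2 * (X.2 * sphereMetric e p.1 Y.1 Z.1
          + Y.2 * sphereMetric e p.1 X.1 Z.1 - Z.2 * sphereMetric e p.1 X.1 Y.1)
        + Real.sinh p.2 ^ 2 * christoffelOne (sphereMetric e) p.1 X.1 Y.1 Z.1 := by
  unfold christoffelOne
  rw [fderiv_hyperbolicMetric he, fderiv_hyperbolicMetric he, fderiv_hyperbolicMetric he]
  ring

variable {e : OpenPartialHomeomorph (UnitSphere n) (EucSp n)} {z : UnitSphere n → ℝ}

theorem fderiv_radialGraph {y : EucSp n} (hz : DifferentiableAt ℝ (fun w => z (e.symm w)) y)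
    (ξ : EucSp n) :
    fderiv ℝ (radialGraph e z) y ξ = (ξ, fderiv ℝ (fun w => z (e.symm w)) y ξ) := by
  have h : HasFDerivAt (radialGraph e z) _ y := (hasFDerivAt_id y).prodMk hz.hasFDerivAt
  rw [h.fderiv]
  rfl

theorem fderiv_fderiv_radialGraph (hz : ContDiff ℝ 2 fun w => z (e.symm w)) (y ξ η : EucSp n) :
    fderiv ℝ (fun w => fderiv ℝ (radialGraph e z) w η) y ξ
      = (0, fderiv ℝ (fderiv ℝ fun w => z (e.symm w)) y ξ η) := by
  have e1 : (fun w => fderiv ℝ (radialGraph e z) w η)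
      = fun w => (η, fderiv ℝ (fun w => z (e.symm w)) w η) :=
    funext fun w => fderiv_radialGraph (hz.differentiable (by norm_num) w) η
  have h1 : HasFDerivAt (fderiv ℝ fun w => z (e.symm w))
      (fderiv ℝ (fderiv ℝ fun w => z (e.symm w)) y) y :=
    ((hz.fderiv_right (m := 1) (by norm_num)).differentiable (by norm_num) y).hasFDerivAt
  have h2 : HasFDerivAt (fun w => fderiv ℝ (fun w => z (e.symm w)) w η)
      ((fderiv ℝ (fderiv ℝ fun w => z (e.symm w)) y).flip η) y :=
    (ContinuousLinearMap.apply ℝ ℝ η).hasFDerivAt.comp y h1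
  rw [e1, ((hasFDerivAt_const η y).prodMk h2).fderiv]
  rfl

/-- The logarithmic coordinate `log (tanh (ρ / 2))` of a radial graph, in which the metric
of hyperbolic space is conformal to that of the cylinder. -/
noncomputable def logRadial (e : OpenPartialHomeomorph (UnitSphere n) (EucSp n))
    (z : UnitSphere n → ℝ) (y : EucSp n) : ℝ :=
  Real.log (Real.tanh (z (e.symm y) / 2))

/-- The first fundamental form of a graph in the cylinder `Sⁿ × ℝ`. -/
noncomputable def cylinderForm (e : OpenPartialHomeomorph (UnitSphere n) (EucSp n))
    (z : UnitSphere n → ℝ) (y ξ η : EucSp n) : ℝ :=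
  sphereMetric e y ξ η + fderiv ℝ (logRadial e z) y ξ * fderiv ℝ (logRadial e z) y η

/-- Minus the Hessian of the logarithmic coordinate, where `a` is the gradient of the latter. -/
noncomputable def negHessian (e : OpenPartialHomeomorph (UnitSphere n) (EucSp n))
    (z : UnitSphere n → ℝ) (a y ξ η : EucSp n) : ℝ :=
  -fderiv ℝ (fderiv ℝ (logRadial e z)) y ξ η + christoffelOne (sphereMetric e) y ξ η a

theorem firstForm_radialGraph (hz : ContDiff ℝ 2 fun w => z (e.symm w)) (hpos : ∀ u, 0 < z u)
    (y ξ η : EucSp n) :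
    firstForm (hyperbolicMetric e) (radialGraph e z) y ξ η
      = Real.sinh (z (e.symm y)) ^ 2 * cylinderForm e z y ξ η := by
  have hd := hz.differentiable (by norm_num) y
  have hs : 0 < Real.sinh (z (e.symm y)) := Real.sinh_pos_iff.2 (hpos _)
  have hv : ∀ ξ, fderiv ℝ (logRadial e z) y ξ
      = (Real.sinh (z (e.symm y)))⁻¹ * fderiv ℝ (fun w => z (e.symm w)) y ξ :=
    fun ξ => DFunLike.congr_fun (fderiv_log_tanh_half_comp hd (hpos _)) ξ
  rw [firstForm, fderiv_radialGraph hd, fderiv_radialGraph hd, cylinderForm, hv, hv]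
  simp only [hyperbolicMetric, radialGraph]
  field_simp
  ring

/-- The inner normal of a radial graph determines the gradient `a` of the logarithmic
coordinate, and the second fundamental form is expressed through the Hessian of the latter. -/
theorem IsInnerNormal.exists_gradient (he : ContDiff ℝ ∞ fun w => (e.symm w : EucSp (n + 1)))
    (hz : ContDiff ℝ 2 fun w => z (e.symm w)) (hpos : ∀ u, 0 < z u) {y : EucSp n}
    {N : EucSp n × ℝ} (hN : IsInnerNormal e z y N) :
    ∃ (a : EucSp n) (ν : ℝ), 0 < ν ∧ ν ^ 2 * (1 + sphereMetric e y a a) = 1 ∧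
      (∀ ξ, sphereMetric e y ξ a = fderiv ℝ (logRadial e z) y ξ) ∧
      ∀ ξ η, secondForm (hyperbolicMetric e) (radialGraph e z) N y ξ η
        = ν * Real.sinh (z (e.symm y))
          * (negHessian e z a y ξ η + Real.cosh (z (e.symm y)) * cylinderForm e z y ξ η) := by
  have hd := hz.differentiable (by norm_num) y
  have hs : 0 < Real.sinh (z (e.symm y)) := Real.sinh_pos_iff.2 (hpos _)
  have hv : ∀ ξ, fderiv ℝ (logRadial e z) y ξ
      = (Real.sinh (z (e.symm y)))⁻¹ * fderiv ℝ (fun w => z (e.symm w)) y ξ :=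
    fun ξ => DFunLike.congr_fun (fderiv_log_tanh_half_comp hd (hpos _)) ξ
  have hvv : ∀ ξ η, fderiv ℝ (fderiv ℝ (logRadial e z)) y ξ η = _ :=
    fun ξ η => fderiv_fderiv_log_tanh_half_comp hz (fun w => hpos _) y ξ η
  obtain ⟨N₁, N₂⟩ := N
  have h1 := hN.unit
  have h2 := hN.orthogonal
  have h3 := hN.inward
  simp only [fderiv_radialGraph hd, hyperbolicMetric, radialGraph] at h1 h2 h3
  set s := Real.sinh (z (e.symm y)) with hsdef
  have hN₂ : N₂ ≠ 0 := h3.ne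
  -- Orthogonality reads `N₂ dz(ξ) + s² e(ξ, N₁) = 0`. With `dv = dz / s` this makes the rescaled
  -- `N₁` the gradient of `v`.
  obtain ⟨a, ha⟩ : ∃ a, a = (s / -N₂) • N₁ := ⟨_, rfl⟩
  have hNa : N₁ = (-N₂ / s) • a := by
    rw [ha, smul_smul]
    have : -N₂ / s * (s / -N₂) = 1 := by field_simp
    rw [this, one_smul]
  have hEa : ∀ ξ, sphereMetric e y ξ a = fderiv ℝ (logRadial e z) y ξ := by
    intro ξ
    have := h2 ξ
    rw [hNa, sphereMetric_smul_right] at this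
    rw [hv]
    field_simp at this ⊢
    have h4 : N₂ * (fderiv ℝ (fun w => z (e.symm w)) y ξ - s * sphereMetric e y ξ a) = 0 := by
      linear_combination this
    have := (mul_eq_zero.1 h4).resolve_left hN₂
    linarith
  refine ⟨a, -N₂, by linarith, ?_, hEa, fun ξ η => ?_⟩
  · rw [hNa, sphereMetric_smul_right, sphereMetric_comm, sphereMetric_smul_right] at h1
    field_simp at h1
    linear_combination h1
  · rw [secondForm, fderiv_fderiv_radialGraph hz, christoffelOne_hyperbolicMetric he,
      fderiv_radialGraph hd, fderiv_radialGraph hd]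
    simp only [radialGraph, hyperbolicMetric, ← hsdef]
    have hEN : ∀ ζ, sphereMetric e y ζ ((-N₂ / s) • a)
        = -N₂ / s * (s⁻¹ * fderiv ℝ (fun w => z (e.symm w)) y ζ) := fun ζ => by
      rw [sphereMetric_smul_right, hEa, hv]
    rw [hNa, christoffelOne_sphereMetric_smul he, hEN, hEN, hEN, map_zero, negHessian,
      cylinderForm, hvv, hv, hv]
    field_simp
    ring

end Forms

/-! ### Comparison of two graphs at a maximum of `v₁ - v₂`. -/

section Comparison

open Matrix

variable {n : ℕ}

theorem formMatrix_posDef {B : EucSp n →ₗ[ℝ] EucSp n →ₗ[ℝ] ℝ} (hs : ∀ ξ η, B ξ η = B η ξ)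
    (hp : ∀ ξ, ξ ≠ 0 → 0 < B ξ ξ) : (formMatrix fun ξ η => B ξ η).PosDef := by
  refine PosDef.of_dotProduct_mulVec_pos ?_ fun x hx => ?_
  · ext i j; simp [formMatrix, hs]
  · have hX : WithLp.toLp 2 x = ∑ i, x i • (EuclideanSpace.single i (1 : ℝ) : EucSp n) := by
      ext j; simp [Finset.sum_apply, Pi.single_apply]
    have h := hp (WithLp.toLp 2 x) (by simpa using hx)
    rw [hX] at h
    simp only [map_sum, LinearMap.sum_apply, map_smul, LinearMap.smul_apply, smul_eq_mul] at h
    refine h.trans_eq (Finset.sum_congr rfl fun i _ => ?_)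
    rw [star_trivial]
    congr 1
    refine Finset.sum_congr rfl fun j _ => ?_
    exact (congrArg (x j * ·) (hs _ _)).trans (mul_comm _ _)

/-- The differential of `v` determines both the gradient and the normal factor. This serves two
graphs with equal differentials as well as two normals of one graph. -/
theorem gradient_unique {e : OpenPartialHomeomorph (UnitSphere n) (EucSp n)} {y : EucSp n}
    (he : Function.Injective (fderiv ℝ (fun w => (e.symm w : EucSp (n + 1))) y))
    {φ : EucSp n → ℝ} {a₁ a₂ : EucSp n} {ν₁ ν₂ : ℝ} (hν₁ : 0 < ν₁) (hν₂ : 0 < ν₂)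
    (hν₁' : ν₁ ^ 2 * (1 + sphereMetric e y a₁ a₁) = 1)
    (hν₂' : ν₂ ^ 2 * (1 + sphereMetric e y a₂ a₂) = 1)
    (ha₁ : ∀ ξ, sphereMetric e y ξ a₁ = φ ξ) (ha₂ : ∀ ξ, sphereMetric e y ξ a₂ = φ ξ) :
    a₁ = a₂ ∧ ν₁ = ν₂ := by
  obtain rfl : a₁ = a₂ := by
    by_contra hne
    have h := sphereMetric_self_pos he (sub_ne_zero.2 hne)
    rw [sphereMetric_sub_right, ha₁, ha₂, sub_self] at h
    exact lt_irrefl _ h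
  refine ⟨rfl, ?_⟩
  have hE : (0 : ℝ) < 1 + sphereMetric e y a₁ a₁ := by
    have : 0 ≤ sphereMetric e y a₁ a₁ := real_inner_self_nonneg
    linarith
  have h : ν₁ ^ 2 = ν₂ ^ 2 := mul_right_cancel₀ hE.ne' (hν₁'.trans hν₂'.symm)
  exact (pow_left_inj₀ hν₁.le hν₂.le two_ne_zero).1 h

/-- `cylinderForm` as a bilinear form. -/
noncomputable def cylinderBilin (e : OpenPartialHomeomorph (UnitSphere n) (EucSp n))
    (z : UnitSphere n → ℝ) (y : EucSp n) : EucSp n →ₗ[ℝ] EucSp n →ₗ[ℝ] ℝ :=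
  LinearMap.mk₂ ℝ (cylinderForm e z y)
    (fun _ _ _ => by simp [cylinderForm, sphereMetric, inner_add_left]; ring)
    (fun _ _ _ => by simp [cylinderForm, sphereMetric, inner_smul_left]; ring)
    (fun _ _ _ => by simp [cylinderForm, sphereMetric, inner_add_right]; ring)
    (fun _ _ _ => by simp [cylinderForm, sphereMetric, inner_smul_right]; ring)

theorem cylinderForm_comm (e : OpenPartialHomeomorph (UnitSphere n) (EucSp n))
    (z : UnitSphere n → ℝ) (y ξ η : EucSp n) : cylinderForm e z y ξ η = cylinderForm e z y η ξ := by
  rw [cylinderForm, cylinderForm, sphereMetric_comm]; ring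

theorem cylinderForm_self_pos {e : OpenPartialHomeomorph (UnitSphere n) (EucSp n)} {y : EucSp n}
    (he : Function.Injective (fderiv ℝ (fun w => (e.symm w : EucSp (n + 1))) y))
    (z : UnitSphere n → ℝ) {ξ : EucSp n} (hξ : ξ ≠ 0) : 0 < cylinderForm e z y ξ ξ :=
  add_pos_of_pos_of_nonneg (sphereMetric_self_pos he hξ) (mul_self_nonneg _)

theorem posDef_formMatrix_cylinderForm {e : OpenPartialHomeomorph (UnitSphere n) (EucSp n)}
    {y : EucSp n} (he : Function.Injective (fderiv ℝ (fun w => (e.symm w : EucSp (n + 1))) y))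
    (z : UnitSphere n → ℝ) : (formMatrix (cylinderForm e z y)).PosDef :=
  formMatrix_posDef (B := cylinderBilin e z y) (cylinderForm_comm e z y)
    fun _ hξ => cylinderForm_self_pos he z hξ

theorem IsPrincipalCurvatures.smul_pencil {z : UnitSphere n → ℝ} {u : UnitSphere n}
    {κ : Fin n → ℝ} (hz : ContMDiff (𝓡 n) 𝓘(ℝ, ℝ) 2 z) (hpos : ∀ u, 0 < z u)
    (hκ : IsPrincipalCurvatures z u κ) :
    ∃ (a : EucSp n) (ν : ℝ), 0 < ν ∧
      ν ^ 2 * (1 + sphereMetric (chartAt (EucSp n) u) (chartAt (EucSp n) u u) a a) = 1 ∧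
      (∀ ξ, sphereMetric (chartAt (EucSp n) u) (chartAt (EucSp n) u u) ξ a
        = fderiv ℝ (logRadial (chartAt (EucSp n) u) z) (chartAt (EucSp n) u u) ξ) ∧
      ∀ x : ℝ, ((formMatrix fun ξ η =>
          negHessian (chartAt (EucSp n) u) z a (chartAt (EucSp n) u u) ξ η
            + Real.cosh (z u) * cylinderForm (chartAt (EucSp n) u) z (chartAt (EucSp n) u u) ξ η)
          - x • formMatrix (cylinderForm (chartAt (EucSp n) u) z (chartAt (EucSp n) u u))).det
        = (formMatrix (cylinderForm (chartAt (EucSp n) u) z (chartAt (EucSp n) u u))).det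
          * ∏ i, (Real.sinh (z u) / ν * κ i - x) := by
  obtain ⟨N, hN, hdet⟩ := hκ
  have hu : (chartAt (EucSp n) u).symm (chartAt (EucSp n) u u) = u :=
    (chartAt (EucSp n) u).left_inv (mem_chart_source _ u)
  obtain ⟨a, ν, hν, hν', ha, hb⟩ := hN.exists_gradient (contDiff_coe_chartAt_symm u)
    (contDiff_comp_chartAt_symm hz u) hpos
  have hg := firstForm_radialGraph (contDiff_comp_chartAt_symm hz u) hpos (chartAt (EucSp n) u u)
  rw [hu] at hb hg
  refine ⟨a, ν, hν, hν', ha, fun x => ?_⟩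
  generalize chartAt (EucSp n) u = e at *
  have hs : 0 < Real.sinh (z u) := Real.sinh_pos_iff.2 (hpos _)
  set s := Real.sinh (z u)
  have hgm : formMatrix (firstForm (hyperbolicMetric e) (radialGraph e z) (e u))
      = s ^ 2 • formMatrix (cylinderForm e z (e u)) := by
    ext i j; simp [formMatrix, hg]
  have hbm : formMatrix (secondForm (hyperbolicMetric e) (radialGraph e z) N (e u))
      = (ν * s) • formMatrix fun ξ η => negHessian e z a (e u) ξ η
            + Real.cosh (z u) * cylinderForm e z (e u) ξ η := by
    ext i j; simp [formMatrix, hb]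
  -- This value makes the scalars match: `b - (ν / s) x g` is `ν s` times the cylinder pencil at
  -- `x`.
  have h := hdet (ν / s * x)
  rw [hgm, hbm] at h
  have e1 : ∀ A B : Matrix (Fin n) (Fin n) ℝ, (ν * s) • A - (ν / s * x) • s ^ 2 • B
      = (ν * s) • (A - x • B) := by
    intro A B
    rw [smul_sub, smul_smul, smul_smul]
    congr 2
    field_simp
  have e2 : ∏ i, (κ i - ν / s * x) = (ν / s) ^ n * ∏ i, (s / ν * κ i - x) := by
    have : (ν / s) ^ n = ∏ _i : Fin n, (ν / s) := by
      rw [Finset.prod_const, Finset.card_univ, Fintype.card_fin]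
    rw [this, ← Finset.prod_mul_distrib]
    refine Finset.prod_congr rfl fun i _ => ?_
    field_simp
  rw [e1, det_smul, det_smul, e2, Fintype.card_fin] at h
  have e3 : (s ^ 2) ^ n * (ν / s) ^ n = (ν * s) ^ n := by
    rw [← mul_pow]; congr 1; field_simp
  have hne : (ν * s) ^ n ≠ 0 := by positivity
  apply mul_left_cancel₀ hne
  rw [h, ← e3]
  ring

theorem logRadial_contDiff {z : UnitSphere n → ℝ} (hz : ContMDiff (𝓡 n) 𝓘(ℝ, ℝ) 2 z)
    (hpos : ∀ u, 0 < z u) (u : UnitSphere n) :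
    ContDiff ℝ 2 (logRadial (chartAt (EucSp n) u) z) :=
  contDiff_log_tanh_half_comp (contDiff_comp_chartAt_symm hz u) fun _ => hpos _

/-- At a maximum of the difference of the logarithmic coordinates of two radial graphs, the outer
graph has the larger value of `H_m` after rescaling by `sinh ρ`. -/
theorem sinh_pow_mul_meanCurv_lt {m : ℕ} (hm : 1 ≤ m) (hmn : m ≤ n) {z₁ z₂ : UnitSphere n → ℝ}
    (hz₁ : ContMDiff (𝓡 n) 𝓘(ℝ, ℝ) 2 z₁) (hz₂ : ContMDiff (𝓡 n) 𝓘(ℝ, ℝ) 2 z₂)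
    (hpos₁ : ∀ u, 0 < z₁ u) (hpos₂ : ∀ u, 0 < z₂ u) {u : UnitSphere n}
    (hmax : ∀ w, Real.log (Real.tanh (z₁ w / 2)) - Real.log (Real.tanh (z₂ w / 2))
      ≤ Real.log (Real.tanh (z₁ u / 2)) - Real.log (Real.tanh (z₂ u / 2)))
    (hlt : z₂ u < z₁ u) {κ₁ κ₂ : Fin n → ℝ} (hκ₁ : IsPrincipalCurvatures z₁ u κ₁)
    (hκ₂ : IsPrincipalCurvatures z₂ u κ₂) (hc : Multiset.InCone m (Finset.univ.val.map κ₂)) :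
    Real.sinh (z₂ u) ^ m * meanCurv m κ₂ < Real.sinh (z₁ u) ^ m * meanCurv m κ₁ := by
  obtain ⟨a₁, ν₁, hν₁, hν₁', ha₁, hdet₁⟩ := hκ₁.smul_pencil hz₁ hpos₁
  obtain ⟨a₂, ν₂, hν₂, hν₂', ha₂, hdet₂⟩ := hκ₂.smul_pencil hz₂ hpos₂
  have hinj := fderiv_coe_chartAt_symm_injective u (chartAt (EucSp n) u u)
  have hv₁ := logRadial_contDiff hz₁ hpos₁ u
  have hv₂ := logRadial_contDiff hz₂ hpos₂ u
  have hu : (chartAt (EucSp n) u).symm (chartAt (EucSp n) u u) = u :=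
    (chartAt (EucSp n) u).left_inv (mem_chart_source _ u)
  generalize chartAt (EucSp n) u = e at *
  set y := e u
  have hlocmax : IsLocalMax (logRadial e z₁ - logRadial e z₂) y := by
    refine Filter.Eventually.of_forall fun w => ?_
    simp only [Pi.sub_apply, logRadial, hu]
    exact hmax _
  have hd₁ : Differentiable ℝ (logRadial e z₁) := hv₁.differentiable (by norm_num)
  have hd₂ : Differentiable ℝ (logRadial e z₂) := hv₂.differentiable (by norm_num)
  have hdd₁ := (hv₁.fderiv_right (m := 1) (by norm_num)).differentiable (by norm_num)
  have hdd₂ := (hv₂.fderiv_right (m := 1) (by norm_num)).differentiable (by norm_num)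
  have hfd : fderiv ℝ (logRadial e z₁ - logRadial e z₂)
      = fderiv ℝ (logRadial e z₁) - fderiv ℝ (logRadial e z₂) :=
    funext fun w => fderiv_sub (hd₁ w) (hd₂ w)
  have hgrad : fderiv ℝ (logRadial e z₁) y = fderiv ℝ (logRadial e z₂) y := by
    have := hlocmax.fderiv_eq_zero
    rw [hfd] at this
    exact sub_eq_zero.1 this
  have hhess : ∀ ξ, fderiv ℝ (fderiv ℝ (logRadial e z₁)) y ξ ξ
      ≤ fderiv ℝ (fderiv ℝ (logRadial e z₂)) y ξ ξ := by
    intro ξ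
    have := hlocmax.fderiv_fderiv_nonpos (hv₁.sub hv₂) ξ
    rw [hfd, fderiv_sub (hdd₁ y) (hdd₂ y)] at this
    exact sub_nonpos.1 this
  obtain ⟨rfl, rfl⟩ := gradient_unique hinj hν₁ hν₂ hν₁' hν₂' ha₁ fun ξ => by rw [ha₂, hgrad]
  have hcyl : cylinderForm e z₁ y = cylinderForm e z₂ y := by
    ext ξ η; rw [cylinderForm, cylinderForm, hgrad]
  rw [hcyl] at hdet₁
  have hcosh : Real.cosh (z₂ u) < Real.cosh (z₁ u) := by
    rw [Real.cosh_lt_cosh, abs_of_pos (hpos₁ u), abs_of_pos (hpos₂ u)]; exact hlt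
  have hsymm : ∀ {v : EucSp n → ℝ}, ContDiff ℝ 2 v → ∀ ξ η,
      fderiv ℝ (fderiv ℝ v) y ξ η = fderiv ℝ (fderiv ℝ v) y η ξ := fun hv ξ η =>
    (hv.contDiffAt.isSymmSndFDerivAt (by simp)).eq ξ η
  have hB₂ : (formMatrix fun ξ η => negHessian e z₂ a₁ y ξ η
      + Real.cosh (z₂ u) * cylinderForm e z₂ y ξ η).IsHermitian := by
    ext i j
    simp only [formMatrix, conjTranspose_apply, of_apply, star_trivial, negHessian]
    rw [hsymm hv₂, christoffelOne_sphereMetric_comm, cylinderForm_comm]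
  let D : EucSp n →ₗ[ℝ] EucSp n →ₗ[ℝ] ℝ := LinearMap.mk₂ ℝ
    (fun ξ η => fderiv ℝ (fderiv ℝ (logRadial e z₂)) y ξ η
      - fderiv ℝ (fderiv ℝ (logRadial e z₁)) y ξ η)
    (fun _ _ _ => by simp; ring) (fun _ _ _ => by simp; ring)
    (fun _ _ _ => by simp; ring) (fun _ _ _ => by simp; ring)
  -- The gradients agree, so the Christoffel terms cancel. What remains is `-D²(v₁ - v₂)`, which is
  -- semidefinite, plus `(cosh z₁ - cosh z₂) C`, which is definite.
  have hP : ((formMatrix fun ξ η => negHessian e z₁ a₁ y ξ η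
        + Real.cosh (z₁ u) * cylinderForm e z₂ y ξ η)
      - formMatrix fun ξ η => negHessian e z₂ a₁ y ξ η
        + Real.cosh (z₂ u) * cylinderForm e z₂ y ξ η).PosDef := by
    have hDG : ∀ ξ η, (D + (Real.cosh (z₁ u) - Real.cosh (z₂ u)) • cylinderBilin e z₂ y) ξ η
        = fderiv ℝ (fderiv ℝ (logRadial e z₂)) y ξ η
          - fderiv ℝ (fderiv ℝ (logRadial e z₁)) y ξ η
          + (Real.cosh (z₁ u) - Real.cosh (z₂ u)) * cylinderForm e z₂ y ξ η := fun ξ η => rfl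
    have h := formMatrix_posDef (B := D + (Real.cosh (z₁ u) - Real.cosh (z₂ u)) • cylinderBilin e z₂ y)
      (fun ξ η => by rw [hDG, hDG, hsymm hv₁, hsymm hv₂, cylinderForm_comm])
      (fun ξ hξ => by
        rw [hDG]
        have := mul_pos (sub_pos.2 hcosh) (cylinderForm_self_pos hinj z₂ hξ)
        linarith [hhess ξ])
    convert! h using 1
    ext i j
    simp only [formMatrix, Matrix.sub_apply, of_apply, hDG, negHessian]
    ring
  have hc' : Multiset.InCone m (Finset.univ.val.map fun i => Real.sinh (z₂ u) / ν₁ * κ₂ i) := by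
    intro k hk
    rw [esymm_map_mul_left]
    have := hc k hk
    have hs := Real.sinh_pos_iff.2 (hpos₂ u)
    positivity
  have h := esymm_lt_of_posDef_sub (posDef_formMatrix_cylinderForm hinj z₂) hB₂ hP
    (μ₁ := fun i => Real.sinh (z₁ u) / ν₁ * κ₁ i) (μ₂ := fun i => Real.sinh (z₂ u) / ν₁ * κ₂ i)
    (by simpa only [hcyl] using hdet₁) hdet₂ hm hc'
  have hch : (0 : ℝ) < n.choose m := by exact_mod_cast Nat.choose_pos hmn
  rw [esymm_map_mul_left, esymm_map_mul_left, div_pow, div_pow, div_mul_eq_mul_div,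
    div_mul_eq_mul_div, div_lt_div_iff_of_pos_right (by positivity)] at h
  rw [meanCurv_eq_esymm, meanCurv_eq_esymm, ← mul_div_assoc, ← mul_div_assoc]
  exact div_lt_div_of_pos_right h hch

/-- Admissibility and the curvature equation each supply their own list of principal curvatures;
this identifies their `H_m`. It is the rank-one formula with zero perturbation. -/
theorem IsPrincipalCurvatures.esymm_eq {m : ℕ} (hmn : m ≤ n) {z : UnitSphere n → ℝ}
    {u : UnitSphere n} {κ κ' : Fin n → ℝ} (hz : ContMDiff (𝓡 n) 𝓘(ℝ, ℝ) 2 z)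
    (hpos : ∀ u, 0 < z u) (hκ : IsPrincipalCurvatures z u κ) (hκ' : IsPrincipalCurvatures z u κ') :
    (Finset.univ.val.map κ).esymm m = (Finset.univ.val.map κ').esymm m := by
  obtain ⟨a₁, ν₁, hν₁, hν₁', ha₁, hdet₁⟩ := hκ.smul_pencil hz hpos
  obtain ⟨a₂, ν₂, hν₂, hν₂', ha₂, hdet₂⟩ := hκ'.smul_pencil hz hpos
  have hinj := fderiv_coe_chartAt_symm_injective u (chartAt (EucSp n) u u)
  obtain ⟨rfl, rfl⟩ := gradient_unique hinj hν₁ hν₂ hν₁' hν₂' ha₁ ha₂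
  have hdet := (posDef_formMatrix_cylinderForm hinj z).det_pos.ne'
  rcases m with _ | m
  · simp [Multiset.esymm_zero_right]
  have h := esymm_eq_add_of_prod_eq (a := fun _ => 0) (fun x _ => by
    simpa using mul_left_cancel₀ hdet ((hdet₁ x).symm.trans (hdet₂ x))) hmn
  simp only [zero_mul, Finset.sum_const_zero, add_zero] at h
  rw [esymm_map_mul_left, esymm_map_mul_left] at h
  have hs := Real.sinh_pos_iff.2 (hpos u)
  exact mul_left_cancel₀ (by positivity) h

theorem antitoneOn_of_derivWithin_Icc_nonpos {f : ℝ → ℝ} {a b : ℝ}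
    (hf : DifferentiableOn ℝ f (Set.Icc a b))
    (h : ∀ t ∈ Set.Icc a b, derivWithin f (Set.Icc a b) t ≤ 0) : AntitoneOn f (Set.Icc a b) := by
  refine antitoneOn_of_deriv_nonpos (convex_Icc a b) hf.continuousOn
    (hf.mono interior_subset) fun t ht => ?_
  have := h t (interior_subset ht)
  rwa [derivWithin_of_mem_nhds (mem_interior_iff_mem_nhds.1 ht)] at this

/-- The weak comparison principle for radial graphs of prescribed curvature. -/
theorem SolvesCurvatureEq.le {m : ℕ} (hm : 1 ≤ m) (hmn : m ≤ n) {I : Set ℝ}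
    {ψ : UnitSphere n → ℝ → ℝ} (hψ : ∀ u, AntitoneOn (fun t => ψ u t * Real.sinh t ^ m) I)
    {z₁ z₂ : UnitSphere n → ℝ} (hz₁ : IsAdmissible m z₁) (hz₂ : IsAdmissible m z₂)
    (hz₁_mem : ∀ u, z₁ u ∈ I) (hz₂_mem : ∀ u, z₂ u ∈ I)
    (hz₁_eq : SolvesCurvatureEq m ψ z₁) (hz₂_eq : SolvesCurvatureEq m ψ z₂)
    (u : UnitSphere n) : z₁ u ≤ z₂ u := by
  have hmono : StrictMonoOn (fun t : ℝ => Real.log (Real.tanh (t / 2))) (Set.Ioi 0) := by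
    refine strictMonoOn_of_deriv_pos (convex_Ioi 0)
      (fun t ht => (Real.hasDerivAt_log_tanh_half ht).continuousAt.continuousWithinAt)
      fun t ht => ?_
    rw [interior_Ioi] at ht
    rw [(Real.hasDerivAt_log_tanh_half ht).deriv]
    exact inv_pos.2 (Real.sinh_pos_iff.2 ht)
  have hcont : ∀ {z : UnitSphere n → ℝ}, IsAdmissible m z →
      Continuous fun w => Real.log (Real.tanh (z w / 2)) := fun hz =>
    continuous_iff_continuousAt.2 fun w =>
      (Real.hasDerivAt_log_tanh_half (hz.pos w)).continuousAt.comp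
        hz.contMDiff.continuous.continuousAt
  obtain ⟨u₀, -, hu₀⟩ := isCompact_univ.exists_isMaxOn ⟨u, Set.mem_univ u⟩
    ((hcont hz₁).sub (hcont hz₂)).continuousOn
  by_contra! hlt
  have h0 : Real.log (Real.tanh (z₁ u / 2)) - Real.log (Real.tanh (z₂ u / 2))
      ≤ Real.log (Real.tanh (z₁ u₀ / 2)) - Real.log (Real.tanh (z₂ u₀ / 2)) :=
    hu₀ (Set.mem_univ u)
  have h1 := hmono (hz₂.pos u) (hz₁.pos u) hlt
  -- The maximum of `v₁ - v₂` is at least its positive value at `u`.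
  have hlt₀ : z₂ u₀ < z₁ u₀ := (hmono.lt_iff_lt (hz₂.pos u₀) (hz₁.pos u₀)).1 (by
    dsimp only at h1 ⊢; linarith)
  obtain ⟨κ₁, hκ₁, hκ₁'⟩ := hz₁_eq u₀
  obtain ⟨κ₂, hκ₂, hκ₂'⟩ := hz₂_eq u₀
  obtain ⟨κ, hκ, hκΓ⟩ := hz₂.mem_gammaCone u₀
  have h := sinh_pow_mul_meanCurv_lt hm hmn hz₁.contMDiff hz₂.contMDiff hz₁.pos hz₂.pos
    (fun w => hu₀ (Set.mem_univ w)) hlt₀ hκ₁ hκ (gammaCone_subset hmn hκΓ)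
  have e : meanCurv m κ = meanCurv m κ₂ := by
    rw [meanCurv_eq_esymm, meanCurv_eq_esymm, hκ.esymm_eq hmn hz₂.contMDiff hz₂.pos hκ₂]
  rw [e, hκ₁', hκ₂'] at h
  have h2 := hψ u₀ (hz₂_mem u₀) (hz₁_mem u₀) hlt₀.le
  dsimp only at h2
  linarith [mul_comm (ψ u₀ (z₁ u₀)) (Real.sinh (z₁ u₀) ^ m),
    mul_comm (ψ u₀ (z₂ u₀)) (Real.sinh (z₂ u₀) ^ m)]

end Comparison

theorem theorem1p2 (n m : ℕ) (hm : 1 ≤ m) (hmn : m ≤ n)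
    (R₁ R₂ : ℝ) (hR₁ : 0 < R₁) (hR : R₁ < R₂)
    (ψ : UnitSphere n → ℝ → ℝ)
    (hψ_smooth : ContMDiffOn ((𝓡 n).prod 𝓘(ℝ, ℝ)) 𝓘(ℝ, ℝ) ∞
      (fun p : UnitSphere n × ℝ => ψ p.1 p.2) (Set.univ ×ˢ Set.Icc R₁ R₂))
    (hψ_pos : ∀ u, ∀ ρ ∈ Set.Icc R₁ R₂, 0 < ψ u ρ)
    (hψ_mono : ∀ u, ∀ ρ ∈ Set.Icc R₁ R₂,
      derivWithin (fun t => ψ u t * Real.sinh t ^ m) (Set.Icc R₁ R₂) ρ ≤ 0)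
    (z₁ z₂ : UnitSphere n → ℝ)
    (hz₁ : IsAdmissible m z₁) (hz₂ : IsAdmissible m z₂)
    (hz₁_mem : ∀ u, z₁ u ∈ Set.Icc R₁ R₂) (hz₂_mem : ∀ u, z₂ u ∈ Set.Icc R₁ R₂)
    (hz₁_eq : SolvesCurvatureEq m ψ z₁) (hz₂_eq : SolvesCurvatureEq m ψ z₂) :
    ∃ c : ℝ, 0 < c ∧
      (∀ u, c * Real.tanh (z₁ u / 2) = Real.tanh (z₂ u / 2)) ∧
      ((∀ u, ∀ ρ ∈ Set.Icc R₁ R₂,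
          derivWithin (fun t => ψ u t * Real.sinh t ^ m) (Set.Icc R₁ R₂) ρ < 0) →
        c = 1 ∧ z₁ = z₂) := by
  have hdiff : ∀ u, DifferentiableOn ℝ (fun t => ψ u t * Real.sinh t ^ m) (Set.Icc R₁ R₂) := by
    intro u
    have h1 : ContMDiffOn 𝓘(ℝ, ℝ) 𝓘(ℝ, ℝ) ∞ (fun t => ψ u t) (Set.Icc R₁ R₂) :=
      hψ_smooth.comp (t := Set.univ ×ˢ Set.Icc R₁ R₂) (f := fun t => (u, t))
        (contMDiff_const.prodMk contMDiff_id).contMDiffOn fun t ht => ⟨Set.mem_univ _, ht⟩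
    exact (h1.contDiffOn.differentiableOn (by simp)).mul
      (Real.differentiable_sinh.pow m).differentiableOn
  have hanti := fun u => antitoneOn_of_derivWithin_Icc_nonpos (hdiff u) (hψ_mono u)
  -- The comparison principle is symmetric in the two solutions.
  have h : z₁ = z₂ := funext fun u => le_antisymm
    (SolvesCurvatureEq.le hm hmn hanti hz₁ hz₂ hz₁_mem hz₂_mem hz₁_eq hz₂_eq u)
    (SolvesCurvatureEq.le hm hmn hanti hz₂ hz₁ hz₂_mem hz₁_mem hz₂_eq hz₁_eq u)
  exact ⟨1, one_pos, fun u => by rw [one_mul, h], fun _ => ⟨rfl, h⟩⟩
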